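/- A mixed graph $\Gamma$ consists of a simplicial graph $(V,E)$ together with a set $D\subseteq E$ of directed edges, each with a chosen origin and terminus among its two endpoints. We write $[a,b]$ for an undirected edge and $[a,b\rangle$ for an edge directed from $a$ to $b$. The twisted right-angled Artin group of $\Gamma$ is $$T(\Gamma)=\langle V \mid ab=ba \text{ for every undirected edge } [a,b],\ aba=b \text{ for every directed edge } [a,b\rangle\rangle .$$ A cone over a mixed graph $\Gamma$, with tip $w$, is a mixed graph with vertex set $V\sqcup\{w\}$ in which $\Gamma$ is an induced mixed subgraph and every vertex $v$ of $\Gamma$ is joined to $w$ by an edge of type $[v,w]$ or $[v,w\rangle$. Let $\mathcal R$ be the class of (finite) mixed graphs obtained, up to isomorphism, from a single vertex by iterating disjoint unions and cones. A finitely generated monoid $M$ has decidable rational subset membership problem if for every finite family $A$ of monoid generators of $M$, with canonical homomorphism $\phi:A^*\to M$, there is an algorithm which, given a regular language $R\subseteq A^*$ (by a finite automaton) and a word $w\in A^*$, decides whether $\phi(w)\in\phi(R)$. It has decidable submonoid membership problem if for every such $A$ there is an algorithm which, given a finite set $S\subseteq A^*$ and a word $w\in A^*$, decides whether $\phi(w)\in\phi(S^*)$.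 **Theorem.** For every mixed graph $\Gamma$ in $\mathcal R$, the group $T(\Gamma)$ has decidable rational subset membership problem, and it has decidable submonoid membership problem. -/

import Mathlib

universe u

/-- A mixed graph on the vertex set `V`: an underlying simplicial graph, some of whose edges are
directed. `Dir a b` says that `{a, b}` is a directed edge with origin `a` and terminus `b`;
the set `D` of directed edges consists of the edges `{a, b}` with `Dir a b` or `Dir b a`. -/
structure MixedGraph (V : Type*) where
  graph : SimpleGraph V
  Dir : V → V → Prop
  adj_of_dir : ∀ a b, Dir a b → graph.Adj a b
  not_dir_symm : ∀ a b, Dir a b → ¬ Dir b a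

namespace MixedGraph

/-- `{a, b}` is an edge without direction, written `[a, b]`. -/
def Undir {V : Type*} (Γ : MixedGraph V) (a b : V) : Prop :=
  Γ.graph.Adj a b ∧ ¬ Γ.Dir a b ∧ ¬ Γ.Dir b a

/-- The defining relators: `a b a⁻¹ b⁻¹` for every undirected edge `[a, b]`, and the Klein relator
`a b a b⁻¹` for every directed edge from `a` to `b`. -/
def relators {V : Type*} (Γ : MixedGraph V) : Set (FreeGroup V) :=
  {r | (∃ a b, Γ.Undir a b ∧
          r = FreeGroup.of a * FreeGroup.of b * (FreeGroup.of a)⁻¹ * (FreeGroup.of b)⁻¹) ∨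
       (∃ a b, Γ.Dir a b ∧
          r = FreeGroup.of a * FreeGroup.of b * FreeGroup.of a * (FreeGroup.of b)⁻¹)}

/-- The twisted right-angled Artin group `T(Γ)`. -/
abbrev TwistedRAAG {V : Type*} (Γ : MixedGraph V) : Type _ :=
  PresentedGroup Γ.relators

/-- The disjoint union of two mixed graphs. -/
def disjointUnion {V W : Type*} (Γ : MixedGraph V) (Δ : MixedGraph W) : MixedGraph (V ⊕ W) where
  graph := SimpleGraph.sum Γ.graph Δ.graph
  Dir
    | Sum.inl a, Sum.inl b => Γ.Dir a b
    | Sum.inr a, Sum.inr b => Δ.Dir a b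
    | _, _ => False
  adj_of_dir := by
    rintro (a | a) (b | b) h
    · exact Γ.adj_of_dir a b h
    · exact h.elim
    · exact h.elim
    · exact Δ.adj_of_dir a b h
  not_dir_symm := by
    rintro (a | a) (b | b) h
    · exact Γ.not_dir_symm a b h
    · exact h.elim
    · exact h.elim
    · exact Δ.not_dir_symm a b h

/-- The cone over `Γ` with tip `none`: `Γ` is induced on the vertices `some v`, and every vertex
`v` of `Γ` is joined to the tip, by an edge directed from `v` into the tip if `v ∈ S`, and by an
undirected edge if `v ∉ S`. -/
def cone {V : Type*} (Γ : MixedGraph V) (S : Set V) : MixedGraph (Option V) where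
  graph :=
    { Adj := fun x y => match x, y with
        | some a, some b => Γ.graph.Adj a b
        | some _, none => True
        | none, some _ => True
        | none, none => False
      symm := ⟨by
        rintro (_ | a) (_ | b) h
        · exact h
        · trivial
        · trivial
        · exact Γ.graph.adj_symm h⟩
      loopless := ⟨by
        rintro (_ | a) h
        · exact h
        · exact Γ.graph.irrefl h⟩ }
  Dir
    | some a, some b => Γ.Dir a b
    | some a, none => a ∈ S
    | none, _ => False
  adj_of_dir := by
    rintro (_ | a) (_ | b) h
    · exact h
    · trivial
    · trivial
    · exact Γ.adj_of_dir a b h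
  not_dir_symm := by
    rintro (_ | a) (_ | b) h
    · exact h.elim
    · exact h.elim
    · exact id
    · exact Γ.not_dir_symm a b h

/-- The class of mixed graphs obtained from a single vertex by iterating disjoint unions and
cones. The last constructor closes the class under isomorphism of mixed graphs. -/
inductive ClassR : {V : Type u} → MixedGraph V → Prop
  | single {V : Type u} [Unique V] (Γ : MixedGraph V) : ClassR Γ
  | disjointUnion {V W : Type u} {Γ : MixedGraph V} {Δ : MixedGraph W} :
      ClassR Γ → ClassR Δ → ClassR (Γ.disjointUnion Δ)
  | cone {V : Type u} {Γ : MixedGraph V} (S : Set V) : ClassR Γ → ClassR (Γ.cone S)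
  | iso {V W : Type u} {Γ : MixedGraph V} {Δ : MixedGraph W} (e : V ≃ W)
      (adj_iff : ∀ a b, Δ.graph.Adj (e a) (e b) ↔ Γ.graph.Adj a b)
      (dir_iff : ∀ a b, Δ.Dir (e a) (e b) ↔ Γ.Dir a b) : ClassR Γ → ClassR Δ

end MixedGraph

/-- The value in `M` of a word over the alphabet `Fin n`, whose letters are interpreted by `φ`:
this is the canonical homomorphism from the free monoid over the alphabet to `M`. -/
def wordValue {M : Type*} [Monoid M] {n : ℕ} (φ : Fin n → M) (w : List (Fin n)) : M :=
  (w.map φ).prod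

/-- Finite descriptions of finite automata over the alphabet `Fin n`: the list of transitions
`(p, a, q)`, the list of initial states and the list of final states. States are named by natural
numbers. -/
abbrev AutomatonCode (n : ℕ) : Type :=
  List (ℕ × Fin n × ℕ) × List ℕ × List ℕ

/-- The nondeterministic automaton with the given description. -/
def AutomatonCode.toNFA {n : ℕ} (c : AutomatonCode n) : NFA (Fin n) ℕ where
  step p a := {q | (p, a, q) ∈ c.1}
  start := {q | q ∈ c.2.1}
  accept := {q | q ∈ c.2.2}

/-- The monoid `M` is finitely generated and, with respect to every finite family `φ` of monoid
generators, there is an algorithm which, given a regular language `R` (by a finite automaton) and a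
word `w` over the generators, decides whether the value of `w` lies in the rational subset
`φ(R)` of `M`. -/
def DecidableRationalSubsetMembership (M : Type*) [Monoid M] : Prop :=
  Monoid.FG M ∧
    ∀ (n : ℕ) (φ : Fin n → M), Submonoid.closure (Set.range φ) = ⊤ →
      ComputablePred fun p : AutomatonCode n × List (Fin n) =>
        wordValue φ p.2 ∈ wordValue φ '' (p.1.toNFA.accepts : Set (List (Fin n)))

/-- The monoid `M` is finitely generated and, with respect to every finite family `φ` of monoid
generators, there is an algorithm which, given a finite set `S` of words (as a list) and a word `w`
over the generators, decides whether the value of `w` lies in `φ(S*)`. -/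
def DecidableSubmonoidMembership (M : Type*) [Monoid M] : Prop :=
  Monoid.FG M ∧
    ∀ (n : ℕ) (φ : Fin n → M), Submonoid.closure (Set.range φ) = ⊤ →
      ComputablePred fun p : List (List (Fin n)) × List (Fin n) =>
        wordValue φ p.2 ∈
          wordValue φ '' ((KStar.kstar ({s | s ∈ p.1} : Language (Fin n)) :
            Language (Fin n)) : Set (List (Fin n)))

/-! Membership is decided by exhaustive search. If the value of `w` lies in the rational subset,
then some accepting path with that value has length at most a primitive recursive function of the
input, and the finitely many paths up to that length are tested with the word problem. Hence it
suffices that `T(Γ)` has two properties: `ParikhBounded` and `PrimrecWordProblem`. Both pass to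
subgroups, to semidirect products with `ℤ` acting through a finite group, and to free products of
two groups.

These operations build `T(Γ)`. A disjoint union gives a free product. In a cone the relation `v w v
= w` says that the tip `w` conjugates `v` to `v⁻¹`, so the cone group is `T(Γ) ⋊ ℤ`, where the
generator of `ℤ` inverts the generators in `S` and fixes the others; this action factors through the
signs. A single vertex is the cone over the empty graph.

`ParikhBounded` says that the edge multisets of the value-one paths between two vertices of a finite
labelled graph form a semilinear set, with effective bounds for the bases and periods. Only these
bounds are tracked, since a non-empty set of this kind contains the base of one of its linear parts,
hence a small element. For a semidirect product, the finite group is recorded in the vertices, and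
triviality of the `ℤ`-coordinate becomes a hyperplane condition (`BoundedSemilinear.hyperplane`).
For a free product, a value-one path contains trivial subpaths within one factor; replacing these by
shortcut edges, again and again, collapses the path. The sets of value-one paths are thus the least
solution of a system of equations whose right-hand sides come from the factors, and
`exists_least_solution`, a form of Parikh's theorem with semilinear right-hand sides, bounds that
solution.

Finally `ParikhBounded.exists_run_card_le` passes from value one to the value of an arbitrary word,
by moving the letters of the word into the graph. -/

open scoped Pointwise
open Monoid (CoprodI)

/-! ### Linear sets and semilinear sets with bounded bases and periods -/

/-- The linear subset of the free commutative monoid with base `b` and periods `P`. -/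
def linearSet {T : Type*} (b : Multiset T) (P : Set (Multiset T)) : Set (Multiset T) :=
  {b} + (AddSubmonoid.closure P : Set (Multiset T))

theorem mem_linearSet {T : Type*} {b x : Multiset T} {P : Set (Multiset T)} :
    x ∈ linearSet b P ↔ ∃ y ∈ AddSubmonoid.closure P, b + y = x := by
  simp [linearSet]

theorem linearSet_add {T : Type*} (b c : Multiset T) (P Q : Set (Multiset T)) :
    linearSet b P + linearSet c Q = linearSet (b + c) (P ∪ Q) := by
  unfold linearSet
  rw [AddSubmonoid.closure_union, AddSubmonoid.coe_sup, add_add_add_comm, Set.singleton_add_singleton]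

/-- `S` is a union of linear sets whose bases and periods all have at most `B` elements. -/
def BoundedSemilinear {T : Type*} (B : ℕ) (S : Set (Multiset T)) : Prop :=
  ∀ x ∈ S, ∃ (b : Multiset T) (P : Set (Multiset T)), b.card ≤ B ∧ (∀ p ∈ P, p.card ≤ B) ∧
    x ∈ linearSet b P ∧ linearSet b P ⊆ S

namespace BoundedSemilinear

variable {T : Type*} {B C : ℕ} {S R : Set (Multiset T)}

theorem mono (h : BoundedSemilinear B S) (hBC : B ≤ C) : BoundedSemilinear C S := by
  intro x hx
  obtain ⟨b, P, hb, hP, hxb, hS⟩ := h x hx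
  exact ⟨b, P, hb.trans hBC, fun p hp => (hP p hp).trans hBC, hxb, hS⟩

/-- The base of a linear part is itself an element. This is the only consequence of semilinearity
that the decision procedure needs. -/
theorem exists_card_le (h : BoundedSemilinear B S) (hS : S.Nonempty) : ∃ x ∈ S, x.card ≤ B := by
  obtain ⟨x, hx⟩ := hS
  obtain ⟨b, P, hb, -, -, hS⟩ := h x hx
  exact ⟨b, hS (mem_linearSet.2 ⟨0, zero_mem _, add_zero b⟩), hb⟩

theorem singleton {x : Multiset T} (hx : x.card ≤ B) : BoundedSemilinear B {x} := by
  intro y hy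
  obtain rfl := Set.mem_singleton_iff.1 hy
  refine ⟨y, ∅, hx, by simp, ?_, ?_⟩ <;> simp [linearSet]

theorem iUnion {ι : Sort*} {S : ι → Set (Multiset T)} (h : ∀ i, BoundedSemilinear B (S i)) :
    BoundedSemilinear B (⋃ i, S i) := by
  intro x hx
  obtain ⟨i, hi⟩ := Set.mem_iUnion.1 hx
  obtain ⟨b, P, hb, hP, hxb, hS⟩ := h i x hi
  exact ⟨b, P, hb, hP, hxb, hS.trans (Set.subset_iUnion S i)⟩

theorem add (hS : BoundedSemilinear B S) (hR : BoundedSemilinear C R) :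
    BoundedSemilinear (B + C) (S + R) := by
  rintro _ ⟨x, hx, y, hy, rfl⟩
  obtain ⟨b, P, hb, hP, hxb, hPS⟩ := hS x hx
  obtain ⟨c, Q, hc, hQ, hyc, hQR⟩ := hR y hy
  refine ⟨b + c, P ∪ Q, ?_, ?_, ?_, ?_⟩
  · rw [Multiset.card_add]; omega
  · rintro p (hp | hp)
    · exact (hP p hp).trans (by omega)
    · exact (hQ p hp).trans (by omega)
  · rw [← linearSet_add]; exact Set.add_mem_add hxb hyc
  · rw [← linearSet_add]; exact Set.add_subset_add hPS hQR

theorem multiset_sum {ι : Type*} {σ : ι → Set (Multiset T)} (h : ∀ i, BoundedSemilinear B (σ i))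
    (m : Multiset ι) : BoundedSemilinear (m.card * B) (m.map σ).sum := by
  induction m using Multiset.induction with
  | empty =>
    simp only [Multiset.map_zero, Multiset.sum_zero]
    exact singleton (by simp)
  | cons i m ih =>
    rw [Multiset.map_cons, Multiset.sum_cons, Multiset.card_cons]
    exact ((h i).add ih).mono (by rw [Nat.succ_mul]; omega)

theorem image {U : Type*} (f : Multiset T →+ Multiset U) (hf : ∀ x, (f x).card ≤ x.card)
    (hS : BoundedSemilinear B S) : BoundedSemilinear B (f '' S) := by
  rintro _ ⟨x, hx, rfl⟩
  obtain ⟨b, P, hb, hP, hxb, hPS⟩ := hS x hx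
  have key : linearSet (f b) (f '' P) = f '' linearSet b P := by
    unfold linearSet
    rw [Set.image_add, ← AddMonoidHom.map_mclosure f P]
    simp
  refine ⟨f b, f '' P, (hf b).trans hb, ?_, ?_, ?_⟩
  · rintro _ ⟨p, hp, rfl⟩
    exact (hf p).trans (hP p hp)
  · rw [key]; exact Set.mem_image_of_mem _ hxb
  · rw [key]; exact Set.image_mono hPS

theorem of_forall_exists_subset
    (h : ∀ x ∈ S, ∃ X, x ∈ X ∧ X ⊆ S ∧ BoundedSemilinear B X) : BoundedSemilinear B S := by
  intro x hx
  obtain ⟨X, hxX, hXS, hX⟩ := h x hx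
  obtain ⟨b, P, hb, hP, hxb, hPX⟩ := hX x hxX
  exact ⟨b, P, hb, hP, hxb, hPX.trans hXS⟩

end BoundedSemilinear

/-! ### The submonoid generated by a semilinear set -/

/-- The bound for the submonoid generated by a bounded semilinear set. -/
def starBound (m : ℕ) : ℕ := (m + 1) ^ m * 2 ^ (m + 1) ^ m * m

section
variable {T : Type*}

/-- A small multiset is a function on `Fin B`, with `none` filling the unused places; this gives the
count. -/
theorem finite_card_le [Finite T] (B : ℕ) : {p : Multiset T | p.card ≤ B}.Finite ∧
    {p : Multiset T | p.card ≤ B}.ncard ≤ (Nat.card T + 1) ^ B := by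
  classical
  have := Fintype.ofFinite T
  let f : (Fin B → Option T) → Multiset T := fun v => (Multiset.ofList (List.ofFn v)).filterMap id
  have hsub : {p : Multiset T | p.card ≤ B} ⊆ Set.range f := by
    intro p hp
    obtain ⟨l, rfl⟩ := Quot.exists_rep p
    have hl : l.length ≤ B := hp
    refine ⟨fun i => l[i.1]?, ?_⟩
    have : List.ofFn (fun i : Fin B => l[i.1]?) = l.map some ++ List.replicate (B - l.length) none := by
      apply List.ext_getElem
      · simp; omega
      · intro i h1 h2
        by_cases hi : i < l.length
        · simp [hi]
        · simp [List.getElem_append, hi]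
    simp only [f, this]
    simp [Multiset.filterMap_coe, List.filterMap_append, List.filterMap_map]
  have hfin : (Set.range f).Finite := Set.finite_range f
  refine ⟨hfin.subset hsub, (Set.ncard_le_ncard hsub hfin).trans ?_⟩
  rw [← Set.image_univ]
  refine (Set.ncard_image_le Set.finite_univ).trans ?_
  rw [Set.ncard_univ]
  simp [Nat.card_eq_fintype_card]

/-- The summands of `x` are grouped by the linear set that contains them. From each group one copy
of the base is kept as a base, and the further copies count as periods, so that each pair of a base
and a period set is needed only once. -/
theorem exists_finset_cover [Finite T] {B : ℕ} {S : Set (Multiset T)}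
    (h : BoundedSemilinear B S) {x : Multiset T} (hx : x ∈ AddSubmonoid.closure S) :
    ∃ U : Finset ({p : Multiset T // p.card ≤ B} × Set {p : Multiset T // p.card ≤ B}),
      (∀ τ ∈ U, linearSet τ.1.1 (Subtype.val '' τ.2) ⊆ S) ∧
      x ∈ ∑ τ ∈ U, linearSet τ.1.1 ({τ.1.1} ∪ Subtype.val '' τ.2) := by
  classical
  induction hx using AddSubmonoid.closure_induction_left with
  | zero => exact ⟨∅, by simp, by simp⟩
  | add_left s hs y hy ih =>
    obtain ⟨U, hU, hyU⟩ := ih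
    obtain ⟨b, P, hb, hP, hsb, hPS⟩ := h s hs
    let τ : {p : Multiset T // p.card ≤ B} × Set {p : Multiset T // p.card ≤ B} :=
      (⟨b, hb⟩, Subtype.val ⁻¹' P)
    have hτ : Subtype.val '' τ.2 = P := by
      exact Subtype.image_preimage_val _ _ |>.trans (Set.inter_eq_right.2 hP)
    have hτ1 : τ.1.1 = b := rfl
    obtain ⟨z, hz, rfl⟩ := mem_linearSet.1 hsb
    have hmono : AddSubmonoid.closure P ≤ AddSubmonoid.closure ({b} ∪ P) :=
      AddSubmonoid.closure_mono Set.subset_union_right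
    by_cases hmem : τ ∈ U
    · refine ⟨U, hU, ?_⟩
      rw [← Finset.add_sum_erase _ _ hmem] at hyU ⊢
      obtain ⟨u, hu, v, hv, rfl⟩ := hyU
      rw [hτ, hτ1] at hu ⊢
      obtain ⟨u', hu', rfl⟩ := mem_linearSet.1 hu
      -- The linear set already occurs, so the new copy of `b` is absorbed as a period.
      refine Set.mem_add.2 ⟨b + ((b + z) + u'), mem_linearSet.2 ⟨_, ?_, rfl⟩, v, hv, by
        simp only []; abel⟩
      exact add_mem (add_mem (AddSubmonoid.subset_closure (Or.inl rfl)) (hmono hz)) hu'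
    · refine ⟨insert τ U, ?_, ?_⟩
      · intro σ hσ
        rcases Finset.mem_insert.1 hσ with rfl | hσ
        · rw [hτ]; exact hPS
        · exact hU σ hσ
      · rw [Finset.sum_insert hmem]
        refine Set.add_mem_add ?_ hyU
        rw [hτ, hτ1]
        exact mem_linearSet.2 ⟨z, hmono hz, rfl⟩

/-- An element `b + (k b + v)` is the sum of `k` copies of `b` and of `b + v`, which all lie in `S`.
-/
theorem linearSet_insert_subset {S : Set (Multiset T)} {b : Multiset T} {P : Set (Multiset T)}
    (h : linearSet b P ⊆ S) :
    linearSet b ({b} ∪ P) ⊆ (AddSubmonoid.closure S : Set (Multiset T)) := by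
  intro x hx
  obtain ⟨y, hy, rfl⟩ := mem_linearSet.1 hx
  have hb : b ∈ AddSubmonoid.closure S :=
    AddSubmonoid.subset_closure (h (mem_linearSet.2 ⟨0, zero_mem _, add_zero b⟩))
  rw [AddSubmonoid.closure_union, AddSubmonoid.mem_sup] at hy
  obtain ⟨u, hu, v, hv, rfl⟩ := hy
  have hu' : u ∈ AddSubmonoid.closure S :=
    (AddSubmonoid.closure_le (S := AddSubmonoid.closure S)).2 (Set.singleton_subset_iff.2 hb) hu
  have hbv : b + v ∈ AddSubmonoid.closure S :=
    AddSubmonoid.subset_closure (h (mem_linearSet.2 ⟨v, hv, rfl⟩))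
  rw [show b + (u + v) = u + (b + v) by abel]
  exact add_mem hu' hbv

theorem sum_linearSet_subset {ι : Type*} {M : AddSubmonoid (Multiset T)} (U : Finset ι)
    {L : ι → Set (Multiset T)} (h : ∀ i ∈ U, L i ⊆ M) :
    ∑ i ∈ U, L i ⊆ (M : Set (Multiset T)) := by
  classical
  induction U using Finset.induction with
  | empty => simp
  | insert i U hi ih =>
    rw [Finset.sum_insert hi]
    rintro _ ⟨x, hx, y, hy, rfl⟩
    exact add_mem (h i (Finset.mem_insert_self _ _) hx)
      (ih (fun j hj => h j (Finset.mem_insert_of_mem hj)) hy)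

theorem exists_sum_linearSet_eq {ι : Type*} (U : Finset ι) (b : ι → Multiset T)
    (P : ι → Set (Multiset T)) :
    ∑ i ∈ U, linearSet (b i) (P i) = linearSet (∑ i ∈ U, b i) (⋃ i ∈ U, P i) := by
  classical
  induction U using Finset.induction with
  | empty => simpa [linearSet] using Set.singleton_zero.symm
  | insert i U hi ih =>
    rw [Finset.sum_insert hi, ih, linearSet_add, Finset.sum_insert hi, Finset.set_biUnion_insert]

/-- By `exists_finset_cover`, every element lies in a sum of distinct linear sets. There are at most
`(m + 1) ^ m` possible bases and `2 ^ (m + 1) ^ m` possible period sets, and every base contributes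
at most `m` to the new base; this is `starBound`. -/
theorem BoundedSemilinear.closure [Finite T] {m : ℕ} {S : Set (Multiset T)} (hT : Nat.card T ≤ m)
    (h : BoundedSemilinear m S) :
    BoundedSemilinear (starBound m) (AddSubmonoid.closure S : Set (Multiset T)) := by
  classical
  intro x hx
  obtain ⟨U, hU, hxU⟩ := exists_finset_cover h hx
  obtain ⟨hfin, hcard⟩ := finite_card_le (T := T) m
  have hc : (Nat.card T + 1) ^ m ≤ (m + 1) ^ m := Nat.pow_le_pow_left (by omega) m
  have hpos : 1 ≤ (m + 1) ^ m * 2 ^ (m + 1) ^ m :=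
    Nat.one_le_iff_ne_zero.2 (by positivity)
  have hsmall : m ≤ starBound m := Nat.le_mul_of_pos_left m hpos
  have hUcard : U.card ≤ (m + 1) ^ m * 2 ^ (m + 1) ^ m := by
    have : Finite {p : Multiset T // p.card ≤ m} := hfin
    have := Fintype.ofFinite {p : Multiset T // p.card ≤ m}
    refine (Finset.card_le_univ U).trans ?_
    rw [Fintype.card_prod, Fintype.card_set]
    have : Fintype.card {p : Multiset T // p.card ≤ m} ≤ (m + 1) ^ m := by
      rw [← Nat.card_eq_fintype_card]
      exact (show _ ≤ _ from hcard).trans hc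
    exact Nat.mul_le_mul this (Nat.pow_le_pow_right (by norm_num) this)
  refine ⟨∑ τ ∈ U, τ.1.1, ⋃ τ ∈ U, ({τ.1.1} ∪ Subtype.val '' τ.2), ?_, ?_, ?_, ?_⟩
  · rw [Multiset.card_sum]
    refine (Finset.sum_le_card_nsmul U _ m fun τ _ => τ.1.2).trans ?_
    exact Nat.mul_le_mul_right m hUcard
  · intro p hp
    simp only [Set.mem_iUnion] at hp
    obtain ⟨τ, -, hp⟩ := hp
    refine le_trans ?_ hsmall
    rcases hp with hp | ⟨q, -, rfl⟩
    · rw [Set.mem_singleton_iff.1 hp]; exact τ.1.2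
    · exact q.2
  · rw [← exists_sum_linearSet_eq]; exact hxU
  · rw [← exists_sum_linearSet_eq]
    exact sum_linearSet_subset U fun τ hτ => linearSet_insert_subset (hU τ hτ)

end

/-! ### Zero-sum parts and intersections with hyperplanes -/

section ZeroSum

variable {α : Type*} (w : α → ℤ) (A : ℕ)

/-- Elements with bounded integral weights and bounded total weight can be arranged in such a way
that all partial sums are bounded. -/
theorem exists_list_bounded_sums (Q : Multiset α) (hw : ∀ a ∈ Q, |w a| ≤ A)
    (hQ : |(Q.map w).sum| ≤ A) :
    ∃ l : List α, (l : Multiset α) = Q ∧ ∀ k, |((l.take k).map w).sum| ≤ A := by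
  classical
  induction h : Q.card generalizing Q with
  | zero =>
    obtain rfl := Multiset.card_eq_zero.1 h
    exact ⟨[], rfl, by simp⟩
  | succ n ih =>
    -- This `q` goes last. Removing a `q` of the same sign as the total keeps the total within `[-A,
    -- A]`, and not all weights can have the opposite sign.
    have hex : ∃ q ∈ Q, |(Q.map w).sum - w q| ≤ A := by
      by_contra! hcon
      have hne : Q ≠ 0 := by rintro rfl; simp at h
      obtain ⟨q₀, hq₀⟩ := Multiset.exists_mem_of_ne_zero hne
      rcases le_or_gt 0 (Q.map w).sum with hs | hs
      · have hneg : ∀ q ∈ Q, w q < 0 := by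
          intro q hq
          by_contra! h0
          have h1 := hcon q hq
          have h2 := hw q hq
          rw [abs_le] at h2 hQ
          rw [lt_abs] at h1
          omega
        have : (Q.map w).sum < 0 := by
          have := Multiset.sum_lt_sum_of_nonempty (f := w) (g := fun _ => (0 : ℤ)) hne hneg
          simpa using this
        omega
      · have hpos : ∀ q ∈ Q, 0 ≤ w q := by
          intro q hq
          by_contra! h0
          have h1 := hcon q hq
          have h2 := hw q hq
          rw [abs_le] at h2 hQ
          rw [lt_abs] at h1
          omega
        have : 0 ≤ (Q.map w).sum :=
          Multiset.sum_nonneg (by simpa using hpos)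
        omega
    obtain ⟨q, hq, hqs⟩ := hex
    have hsum : (Q.map w).sum = w q + ((Q.erase q).map w).sum := by
      rw [← Multiset.sum_cons, ← Multiset.map_cons, Multiset.cons_erase hq]
    obtain ⟨l, hl, hls⟩ := ih (Q.erase q) (fun a ha => hw a (Multiset.mem_of_mem_erase ha))
      (by rw [hsum] at hqs; simpa using hqs) (by rw [Multiset.card_erase_of_mem hq, h]; rfl)
    have hlq : ((l ++ [q] : List α) : Multiset α) = Q := by
      rw [← Multiset.coe_add, hl, Multiset.coe_singleton, add_comm, Multiset.singleton_add,
        Multiset.cons_erase hq]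
    refine ⟨l ++ [q], hlq, fun k => ?_⟩
    by_cases hk : k ≤ l.length
    · rw [List.take_append_of_le_length hk]; exact hls k
    · rw [List.take_of_length_le (by simp; omega)]
      rw [← hlq] at hQ
      simpa using hQ

/-- A large multiset of elements with bounded integral weights and bounded total weight contains a
small non-empty part of total weight zero. -/
theorem exists_zero_sum_part (Q : Multiset α) (hw : ∀ a ∈ Q, |w a| ≤ A)
    (hQ : |(Q.map w).sum| ≤ A) (hcard : 2 * A + 1 ≤ Q.card) :
    ∃ R ≤ Q, R ≠ 0 ∧ R.card ≤ 2 * A + 1 ∧ (R.map w).sum = 0 := by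
  obtain ⟨l, rfl, hl⟩ := exists_list_bounded_sums w A Q hw hQ
  simp only [Multiset.coe_card] at hcard
  -- Pigeonhole: the `2 * A + 2` prefixes have only `2 * A + 1` possible sums, and the segment
  -- between two prefixes of equal sum has weight zero.
  have hmaps : Set.MapsTo (fun k : ℕ => ((l.take k).map w).sum)
      (Finset.range (2 * A + 2) : Finset ℕ) (Finset.Icc (-(A : ℤ)) A : Finset ℤ) := by
    intro k _
    simpa [abs_le] using hl k
  obtain ⟨i, hi, j, hj, hij, heq⟩ := Finset.exists_ne_map_eq_of_card_lt_of_maps_to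
    (by simp; omega) hmaps
  wlog hlt : i < j generalizing i j
  · exact this j hj i hi hij.symm heq.symm (by omega)
  simp only [Finset.mem_range] at hi hj
  have hdec : l.take j = l.take i ++ (l.drop i).take (j - i) := by
    rw [show j = i + (j - i) by omega, List.take_add]
    simp
  refine ⟨((l.drop i).take (j - i) : List α), ?_, ?_, ?_, ?_⟩
  · exact Multiset.coe_le.2
      (((List.take_sublist _ _).trans (List.drop_sublist _ _)).subperm)
  · rw [Ne, Multiset.coe_eq_zero]
    intro h0
    have := congrArg List.length h0
    simp at this
    omega
  · simp
    omega
  · have : ((l.take j).map w).sum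
        = ((l.take i).map w).sum + (((l.drop i).take (j - i)).map w).sum := by
      rw [hdec, List.map_append, List.sum_append]
    simp only [Multiset.map_coe, Multiset.sum_coe]
    linarith

/-- Zero-sum parts are split off until the rest is small. Removing such a part does not change the
total weight, so the hypotheses persist. -/
theorem exists_zero_sum_decomposition (Q : Multiset α) (hw : ∀ a ∈ Q, |w a| ≤ A)
    (hQ : |(Q.map w).sum| ≤ A) :
    ∃ Q₀ : Multiset α, ∃ Z : Multiset (Multiset α), Q = Q₀ + Z.sum ∧ Q₀.card ≤ 2 * A + 1 ∧
      (Q₀.map w).sum = (Q.map w).sum ∧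
      ∀ R ∈ Z, R ≤ Q ∧ R.card ≤ 2 * A + 1 ∧ (R.map w).sum = 0 := by
  induction h : Q.card using Nat.strong_induction_on generalizing Q with
  | _ n ih =>
    by_cases hcard : Q.card ≤ 2 * A + 1
    · exact ⟨Q, 0, by simp, hcard, rfl, by simp⟩
    obtain ⟨R, hRQ, hR0, hRc, hRs⟩ := exists_zero_sum_part w A Q hw hQ (by omega)
    obtain ⟨Q', rfl⟩ := Multiset.le_iff_exists_add.1 hRQ
    have hRpos : 0 < R.card := Multiset.card_pos.2 hR0
    simp only [Multiset.map_add, Multiset.sum_add, hRs, zero_add] at hQ ⊢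
    obtain ⟨Q₀, Z, hQZ, h1, h2, h3⟩ := ih Q'.card (by rw [← h, Multiset.card_add]; omega) Q'
      (fun a ha => hw a (Multiset.mem_add.2 (Or.inr ha))) hQ rfl
    refine ⟨Q₀, R ::ₘ Z, ?_, h1, h2, ?_⟩
    · rw [Multiset.sum_cons, hQZ]; abel
    · intro R' hR'
      rcases Multiset.mem_cons.1 hR' with rfl | hR'
      · exact ⟨hRQ, hRc, hRs⟩
      · exact ⟨(h3 R' hR').1.trans (Multiset.le_add_left _ _), (h3 R' hR').2⟩

end ZeroSum

/-- The bound for the intersection of a bounded semilinear set with a hyperplane. -/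
def hyperplaneBound (m : ℕ) : ℕ := m + (2 * (m + m * m) + 1) * m

theorem abs_sum_map_le {T : Type*} {m : ℕ} {w : T → ℤ} (hw : ∀ t, |w t| ≤ m) (x : Multiset T) :
    |(x.map w).sum| ≤ x.card * m := by
  induction x using Multiset.induction with
  | empty => simp
  | cons a x ih =>
    rw [Multiset.map_cons, Multiset.sum_cons, Multiset.card_cons]
    refine (abs_add_le _ _).trans ?_
    have := hw a
    push_cast
    linarith

theorem card_sum_le {T : Type*} {m : ℕ} (Q : Multiset (Multiset T)) (h : ∀ p ∈ Q, p.card ≤ m) :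
    Q.sum.card ≤ Q.card * m := by
  induction Q using Multiset.induction with
  | empty => simp
  | cons a Q ih =>
    rw [Multiset.sum_cons, Multiset.card_cons, Multiset.card_add, Nat.succ_mul]
    have := h a (Multiset.mem_cons_self _ _)
    have := ih fun p hp => h p (Multiset.mem_cons_of_mem hp)
    omega

theorem sum_map_sum {T : Type*} (w : T → ℤ) (Q : Multiset (Multiset T)) :
    (Q.sum.map w).sum = (Q.map fun p => (p.map w).sum).sum := by
  induction Q using Multiset.induction with
  | empty => simp
  | cons a Q ih => simp [ih]

/-- Periods have weight at most `m * m`, and those used must have total weight `c - W b`, so the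
zero-sum decomposition applies with `A = m + m * m`. Its remainder joins the base, and its zero-sum
parts become the new periods. -/
theorem BoundedSemilinear.hyperplane {T : Type*} {m : ℕ} {S : Set (Multiset T)}
    (h : BoundedSemilinear m S) (w : T → ℤ) (hw : ∀ t, |w t| ≤ m) (c : ℤ) (hc : |c| ≤ m) :
    BoundedSemilinear (hyperplaneBound m) {x ∈ S | (x.map w).sum = c} := by
  rintro x ⟨hxS, hxc⟩
  obtain ⟨b, P, hb, hP, hxb, hPS⟩ := h x hxS
  obtain ⟨y, hy, rfl⟩ := mem_linearSet.1 hxb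
  obtain ⟨Q, hQP, rfl⟩ := AddSubmonoid.exists_multiset_of_mem_closure hy
  let W : Multiset T → ℤ := fun p => (p.map w).sum
  have hmm : ∀ p : Multiset T, p.card ≤ m → |W p| ≤ (m * m : ℕ) := fun p hp =>
    (abs_sum_map_le hw p).trans (by exact_mod_cast Nat.mul_le_mul_right m hp)
  have hWQ : (Q.map W).sum = c - W b := by
    rw [Multiset.map_add, Multiset.sum_add, sum_map_sum] at hxc
    simp only [W]
    linarith
  obtain ⟨Q₀, Z, hQZ, h1, h2, h3⟩ := exists_zero_sum_decomposition W (m + m * m) Q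
    (fun p hp => (hmm p (hP p (hQP p hp))).trans (by push_cast; omega))
    (by
      rw [hWQ]
      have := hmm b hb
      rw [abs_le] at *
      push_cast at *
      constructor <;> linarith)
  have hQ₀ : ∀ p ∈ Q₀, p ∈ P := fun p hp => hQP p (by rw [hQZ]; exact Multiset.mem_add.2 (Or.inl hp))
  refine ⟨b + Q₀.sum, {r | ∃ R : Multiset (Multiset T), (∀ p ∈ R, p ∈ P) ∧
    R.card ≤ 2 * (m + m * m) + 1 ∧ (R.map W).sum = 0 ∧ r = R.sum}, ?_, ?_, ?_, ?_⟩
  · have := card_sum_le Q₀ fun p hp => hP p (hQ₀ p hp)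
    have := Nat.mul_le_mul_right m h1
    rw [Multiset.card_add, hyperplaneBound]
    omega
  · rintro _ ⟨R, hRP, hRc, -, rfl⟩
    have := card_sum_le R fun p hp => hP p (hRP p hp)
    have := Nat.mul_le_mul_right m hRc
    rw [hyperplaneBound]
    omega
  · refine mem_linearSet.2 ⟨(Z.map Multiset.sum).sum, ?_, ?_⟩
    · refine AddSubmonoid.multiset_sum_mem _ _ fun r hr => AddSubmonoid.subset_closure ?_
      obtain ⟨R, hR, rfl⟩ := Multiset.mem_map.1 hr
      obtain ⟨hRQ, hRc, hRs⟩ := h3 R hR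
      exact ⟨R, fun p hp => hQP p (Multiset.mem_of_le hRQ hp), hRc, hRs, rfl⟩
    · rw [hQZ, Multiset.sum_add, add_assoc]
      congr 2
      clear hQZ h3
      induction Z using Multiset.induction with
      | empty => simp
      | cons a Z ih => simp [ih]
  · intro x hx
    obtain ⟨y, hy, rfl⟩ := mem_linearSet.1 hx
    have key : y ∈ AddSubmonoid.closure P ∧ W y = 0 := by
      induction hy using AddSubmonoid.closure_induction with
      | mem r hr =>
        obtain ⟨R, hRP, -, hR0, rfl⟩ := hr
        refine ⟨AddSubmonoid.multiset_sum_mem _ _ fun p hp =>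
          AddSubmonoid.subset_closure (hRP p hp), ?_⟩
        simp only [W, sum_map_sum] at hR0 ⊢
        exact hR0
      | zero => exact ⟨zero_mem _, by simp [W]⟩
      | add u v _ _ hu hv =>
        refine ⟨add_mem (hu (mem_linearSet.2 ⟨u, ‹_›, rfl⟩)).1 (hv (mem_linearSet.2 ⟨v, ‹_›, rfl⟩)).1, ?_⟩
        have h1 := (hu (mem_linearSet.2 ⟨u, ‹_›, rfl⟩)).2
        have h2 := (hv (mem_linearSet.2 ⟨v, ‹_›, rfl⟩)).2
        simp only [W, Multiset.map_add, Multiset.sum_add] at h1 h2 ⊢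
        omega
    refine ⟨hPS (mem_linearSet.2 ⟨Q₀.sum + y, add_mem ?_ key.1, by abel⟩), ?_⟩
    · exact AddSubmonoid.multiset_sum_mem _ _ fun p hp => AddSubmonoid.subset_closure (hQ₀ p hp)
    · have e1 := key.2
      simp only [W] at e1 h2 hWQ
      rw [Multiset.map_add, Multiset.sum_add, Multiset.map_add, Multiset.sum_add, e1, sum_map_sum,
        h2, hWQ]
      ring

/-! ### Substitution of semilinear sets -/

section Substitution

variable {I J T : Type*}

/-- The set of all multisets obtained from an element of `L` by replacing every occurrence of a
symbol `i` by an element of `σ i`. -/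
def substitute (σ : I → Set (Multiset T)) (L : Set (Multiset I)) : Set (Multiset T) :=
  ⋃ m ∈ L, (m.map σ).sum

theorem mem_substitute {σ : I → Set (Multiset T)} {L : Set (Multiset I)} {x : Multiset T} :
    x ∈ substitute σ L ↔ ∃ m ∈ L, x ∈ (m.map σ).sum := by
  simp [substitute]

theorem sum_map_subset_sum_map {σ τ : I → Set (Multiset T)} (h : ∀ i, σ i ⊆ τ i)
    (m : Multiset I) : (m.map σ).sum ⊆ (m.map τ).sum := by
  induction m using Multiset.induction with
  | empty => simp
  | cons i m ih =>
    simp only [Multiset.map_cons, Multiset.sum_cons]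
    exact Set.add_subset_add (h i) ih

theorem substitute_subset_substitute {σ τ : I → Set (Multiset T)} {L M : Set (Multiset I)}
    (h : ∀ i, σ i ⊆ τ i) (hL : L ⊆ M) : substitute σ L ⊆ substitute τ M := by
  intro x hx
  obtain ⟨m, hm, hx⟩ := mem_substitute.1 hx
  exact mem_substitute.2 ⟨m, hL hm, sum_map_subset_sum_map h m hx⟩

theorem substitute_zero (σ : I → Set (Multiset T)) : substitute σ 0 = 0 := by
  ext x
  simp [mem_substitute, Set.mem_zero]

theorem substitute_singleton (σ : I → Set (Multiset T)) (i : I) : substitute σ {{i}} = σ i := by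
  ext x
  simp [mem_substitute]

theorem substitute_add (σ : I → Set (Multiset T)) (L M : Set (Multiset I)) :
    substitute σ (L + M) = substitute σ L + substitute σ M := by
  ext x
  constructor
  · intro hx
    obtain ⟨m, hm, hx⟩ := mem_substitute.1 hx
    obtain ⟨l, hl, k, hk, rfl⟩ := Set.mem_add.1 hm
    rw [Multiset.map_add, Multiset.sum_add] at hx
    obtain ⟨u, hu, v, hv, rfl⟩ := Set.mem_add.1 hx
    exact Set.add_mem_add (mem_substitute.2 ⟨l, hl, hu⟩) (mem_substitute.2 ⟨k, hk, hv⟩)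
  · intro hx
    obtain ⟨u, hu, v, hv, rfl⟩ := Set.mem_add.1 hx
    obtain ⟨l, hl, hu⟩ := mem_substitute.1 hu
    obtain ⟨k, hk, hv⟩ := mem_substitute.1 hv
    refine mem_substitute.2 ⟨l + k, Set.add_mem_add hl hk, ?_⟩
    rw [Multiset.map_add, Multiset.sum_add]
    exact Set.add_mem_add hu hv

theorem substitute_sum_map (τ : J → Set (Multiset T)) (σ : I → Set (Multiset J))
    (m : Multiset I) :
    substitute τ (m.map σ).sum = (m.map fun i => substitute τ (σ i)).sum := by
  induction m using Multiset.induction with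
  | empty => exact substitute_zero τ
  | cons i m ih => simp only [Multiset.map_cons, Multiset.sum_cons, substitute_add, ih]

theorem substitute_substitute (τ : J → Set (Multiset T)) (σ : I → Set (Multiset J))
    (L : Set (Multiset I)) :
    substitute τ (substitute σ L) = substitute (fun i => substitute τ (σ i)) L := by
  have h : ∀ m : Multiset I, substitute τ (m.map σ).sum = (m.map fun i => substitute τ (σ i)).sum :=
    substitute_sum_map τ σ
  ext x
  constructor
  · intro hx
    obtain ⟨k, hk, hx⟩ := mem_substitute.1 hx
    obtain ⟨m, hm, hk⟩ := mem_substitute.1 hk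
    refine mem_substitute.2 ⟨m, hm, ?_⟩
    rw [← h]
    exact mem_substitute.2 ⟨k, hk, hx⟩
  · intro hx
    obtain ⟨m, hm, hx⟩ := mem_substitute.1 hx
    rw [← h] at hx
    obtain ⟨k, hk, hx⟩ := mem_substitute.1 hx
    exact mem_substitute.2 ⟨k, mem_substitute.2 ⟨m, hm, hk⟩, hx⟩

/-- The bound for a substitution of bounded semilinear sets. -/
def substituteBound (m : ℕ) : ℕ := m * m + starBound (m + m * m)

/-- Substituting into `b + ⟨P⟩` gives the substitution of `b` plus the submonoid generated by the
substitutions of the periods, so the bounds for sums and for `closure` combine. -/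
theorem BoundedSemilinear.substitution [Finite T] {m : ℕ} (hT : Nat.card T ≤ m)
    {σ : I → Set (Multiset T)} {L : Set (Multiset I)} (hL : BoundedSemilinear m L)
    (hσ : ∀ i, BoundedSemilinear m (σ i)) :
    BoundedSemilinear (substituteBound m) (substitute σ L) := by
  refine BoundedSemilinear.of_forall_exists_subset fun x hx => ?_
  obtain ⟨k, hk, hx⟩ := mem_substitute.1 hx
  obtain ⟨b, P, hb, hP, hkb, hPL⟩ := hL k hk
  have hsum : ∀ p : Multiset I, p.card ≤ m → BoundedSemilinear (m * m) (p.map σ).sum := fun p hp =>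
    (BoundedSemilinear.multiset_sum hσ p).mono (Nat.mul_le_mul_right m hp)
  let G : Set (Multiset T) := ⋃ p ∈ P, (p.map σ).sum
  -- The bound `m * m` would do here; the extra `m` makes it dominate `Nat.card T`, as `closure`
  -- requires.
  have hG : BoundedSemilinear (m + m * m) G :=
    (BoundedSemilinear.iUnion fun p => BoundedSemilinear.iUnion fun hp => hsum p (hP p hp)).mono
      (by omega)
  refine ⟨(b.map σ).sum + (AddSubmonoid.closure G : Set (Multiset T)), ?_, ?_,
    (hsum b hb).add (hG.closure (by omega))⟩
  · obtain ⟨y, hy, rfl⟩ := mem_linearSet.1 hkb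
    rw [Multiset.map_add, Multiset.sum_add] at hx
    refine Set.add_subset_add_left ?_ hx
    clear hx hkb hk
    induction hy using AddSubmonoid.closure_induction with
    | mem p hp =>
      exact fun z hz => AddSubmonoid.subset_closure (Set.mem_biUnion hp hz)
    | zero => simp
    | add u v _ _ hu hv =>
      rw [Multiset.map_add, Multiset.sum_add]
      rintro _ ⟨z, hz, z', hz', rfl⟩
      exact add_mem (hu hz) (hv hz')
  · rintro _ ⟨u, hu, v, hv, rfl⟩
    have key : ∃ y ∈ AddSubmonoid.closure P, v ∈ (y.map σ).sum := by
      induction hv using AddSubmonoid.closure_induction with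
      | mem z hz =>
        simp only [G, Set.mem_iUnion] at hz
        obtain ⟨p, hp, hz⟩ := hz
        exact ⟨p, AddSubmonoid.subset_closure hp, hz⟩
      | zero => exact ⟨0, zero_mem _, by simp⟩
      | add z z' _ _ hz hz' =>
        obtain ⟨y, hy, hzy⟩ := hz
        obtain ⟨y', hy', hzy'⟩ := hz'
        refine ⟨y + y', add_mem hy hy', ?_⟩
        rw [Multiset.map_add, Multiset.sum_add]
        exact Set.add_mem_add hzy hzy'
    obtain ⟨y, hy, hvy⟩ := key
    refine mem_substitute.2 ⟨b + y, hPL (mem_linearSet.2 ⟨y, hy, rfl⟩), ?_⟩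
    rw [Multiset.map_add, Multiset.sum_add]
    exact Set.add_mem_add hu hvy

end Substitution

/-! ### Least solutions of systems of equations -/

section Fixpoint

variable {I : Type*}

open Classical in
/-- The substitution that replaces the symbols `i ∈ U` by `X i` and keeps the other symbols. -/
noncomputable def substOn (U : Set I) (X : I → Set (Multiset I)) : I → Set (Multiset I) :=
  fun i => if i ∈ U then X i else {{i}}

theorem substOn_of_mem {U : Set I} {i : I} (h : i ∈ U) (X : I → Set (Multiset I)) :
    substOn U X i = X i := if_pos h

theorem substOn_of_notMem {U : Set I} {i : I} (h : i ∉ U) (X : I → Set (Multiset I)) :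
    substOn U X i = {{i}} := if_neg h

/-- The bound for the least solution of one equation. -/
def fixpointBound (m : ℕ) : ℕ := hyperplaneBound (starBound (m + 1) + 1)

-- An element of the least solution is the yield of a derivation tree whose nodes are elements of
-- `L` and whose inner edges are the occurrences of `a`. Up to commutativity only the multiset of
-- nodes matters, and it forms a tree exactly when the nodes outnumber the occurrences of `a` by
-- one. This is a hyperplane condition on the submonoid generated by `L`, with summands marked.
open Classical in
theorem BoundedSemilinear.exists_fixpoint [Finite I] {m : ℕ} (hI : Nat.card I ≤ m)
    {L : Set (Multiset I)} (hL : BoundedSemilinear m L) (a : I) :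
    ∃ X : Set (Multiset I), BoundedSemilinear (fixpointBound m) X ∧
      substitute (substOn {a} fun _ => X) L ⊆ X ∧
      ∀ Y : Set (Multiset I), substitute (substOn {a} fun _ => Y) L ⊆ Y → X ⊆ Y := by
  -- `Q` is the multiset of nodes of a tree: every node except the root fills one occurrence of `a`.
  let X : Set (Multiset I) := {x | ∃ Q : Multiset (Multiset I), (∀ k ∈ Q, k ∈ L) ∧
    Q.sum.count a + 1 = Q.card ∧ x = Q.sum.filter (· ≠ a)}
  refine ⟨X, ?_, ?_, ?_⟩
  · -- mark every summand with the symbol `none`, and compare numbers of occurrences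
    let L' : Set (Multiset (Option I)) := {{none}} + Multiset.mapAddMonoidHom some '' L
    have hL' : BoundedSemilinear (m + 1) L' := by
      rw [add_comm]
      exact (BoundedSemilinear.singleton (B := 1) (by simp)).add (hL.image _ (by simp))
    -- The marker has weight `-1` and `a` has weight `1`, so the total is the number of occurrences
    -- of `a` minus the number of summands, which has to be `-1`.
    let w : Option I → ℤ := fun o => o.elim (-1) fun i => if i = a then 1 else 0
    have hw : ∀ o, |w o| ≤ 1 := by
      rintro (_ | i)
      · simp [w]
      · by_cases h : i = a <;> simp [w, h]
    have hcl := hL'.closure (by rw [Finite.card_option]; omega)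
    have hyp := (hcl.mono (Nat.le_succ _)).hyperplane w
      (fun o => (hw o).trans (by push_cast; omega)) (-1) (by simp)
    let f : Multiset (Option I) →+ Multiset I :=
      { toFun := fun x => x.filterMap fun o => o.bind fun i => if i = a then none else some i
        map_zero' := rfl
        map_add' := fun x y => Multiset.filterMap_add _ x y }
    have hf : ∀ x, (f x).card ≤ x.card := fun x => by
      simp only [f, AddMonoidHom.coe_mk]
      induction x using Quot.inductionOn with
      | _ l => exact List.length_filterMap_le _ l
    have hX : X = f '' {x ∈ (AddSubmonoid.closure L' : Set (Multiset (Option I))) |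
        (x.map w).sum = -1} := by
      have hmap : ∀ k : Multiset I, f (k.map some) = k.filter (· ≠ a) := by
        intro k
        induction k using Multiset.induction with
        | empty => rfl
        | cons i k ih =>
          rw [Multiset.map_cons, ← Multiset.singleton_add, map_add, ih, Multiset.filter_cons]
          congr 1
          change Multiset.filterMap _ (some i ::ₘ 0) = _
          by_cases h : i = a
          · rw [Multiset.filterMap_cons_none _ _ (by simp [h])]
            simp [h]
          · rw [Multiset.filterMap_cons_some _ _ _ (b := i) (by simp [h])]
            simp [h]
      have hcount : ∀ k : Multiset I, ((k.map some).map w).sum = k.count a := by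
        intro k
        induction k using Multiset.induction with
        | empty => simp
        | cons i k ih =>
          rw [Multiset.map_cons, Multiset.map_cons, Multiset.sum_cons, ih, Multiset.count_cons]
          by_cases h : i = a
          · simp [w, h, add_comm]
          · simp [w, h, Ne.symm h]
      have hsum : ∀ Q : Multiset (Multiset I), ∃ x, x = (Q.map fun k => {none} + k.map some).sum ∧
          f x = Q.sum.filter (· ≠ a) ∧ (x.map w).sum = Q.sum.count a - Q.card := by
        intro Q
        refine ⟨_, rfl, ?_⟩
        induction Q using Multiset.induction with
        | empty => simp
        | cons k Q ih =>
          rw [Multiset.map_cons, Multiset.sum_cons, map_add, map_add, hmap, ih.1]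
          refine ⟨?_, ?_⟩
          · rw [Multiset.sum_cons, Multiset.filter_add, show f {none} = 0 from rfl, zero_add]
          · rw [Multiset.map_add, Multiset.sum_add, Multiset.map_add, Multiset.sum_add, hcount,
              ih.2, Multiset.sum_cons, Multiset.count_add, Multiset.card_cons]
            simp [w]
            ring
      ext x
      constructor
      · rintro ⟨Q, hQ, hc, rfl⟩
        obtain ⟨y, hy, hfy, hwy⟩ := hsum Q
        refine ⟨y, ⟨?_, by rw [hwy, ← hc]; push_cast; ring⟩, hfy⟩
        rw [hy]
        refine AddSubmonoid.multiset_sum_mem _ _ fun z hz => ?_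
        obtain ⟨k, hk, rfl⟩ := Multiset.mem_map.1 hz
        exact AddSubmonoid.subset_closure (Set.add_mem_add rfl ⟨k, hQ k hk, rfl⟩)
      · rintro ⟨y, ⟨hy, hwy⟩, rfl⟩
        obtain ⟨Q, hQ, rfl⟩ : ∃ Q : Multiset (Multiset I), (∀ k ∈ Q, k ∈ L) ∧
            (Q.map fun k => {none} + k.map some).sum = y := by
          clear hwy
          induction hy using AddSubmonoid.closure_induction with
          | mem z hz =>
            obtain ⟨_, rfl, _, ⟨k, hk, rfl⟩, rfl⟩ := hz
            exact ⟨{k}, by simpa using hk, by simp⟩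
          | zero => exact ⟨0, by simp, by simp⟩
          | add u v _ _ hu hv =>
            obtain ⟨Q, hQ, rfl⟩ := hu
            obtain ⟨R, hR, rfl⟩ := hv
            refine ⟨Q + R, fun k hk => (Multiset.mem_add.1 hk).elim (hQ k) (hR k), by simp⟩
        obtain ⟨y, rfl, hfy, hwy'⟩ := hsum Q
        refine ⟨Q, hQ, ?_, hfy⟩
        omega
    rw [hX]
    exact hyp.image f hf
  · intro x hx'
    obtain ⟨k, hk, hx⟩ := mem_substitute.1 hx'
    clear hx'
    -- The trees inserted for the occurrences of `a` in `k` are pooled into one multiset of nodes;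
    -- adding `k` as root afterwards restores the required count.
    obtain ⟨Q, hQ, hc, rfl⟩ : ∃ Q : Multiset (Multiset I), (∀ k ∈ Q, k ∈ L) ∧
        Q.sum.count a + k.count a = Q.card ∧ x = (k + Q.sum).filter (· ≠ a) := by
      clear hk
      induction k using Multiset.induction generalizing x with
      | empty => exact ⟨0, by simp, by simp, by simpa using hx⟩
      | cons i k ih =>
        rw [Multiset.map_cons, Multiset.sum_cons] at hx
        obtain ⟨u, hu, v, hv, rfl⟩ := Set.mem_add.1 hx
        obtain ⟨Q, hQ, hc, rfl⟩ := ih hv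
        by_cases h : i = a
        · subst h
          rw [substOn_of_mem (Set.mem_singleton _)] at hu
          obtain ⟨R, hR, hRc, rfl⟩ := hu
          refine ⟨R + Q, fun k hk => (Multiset.mem_add.1 hk).elim (hR k) (hQ k), ?_, ?_⟩
          · rw [Multiset.sum_add, Multiset.count_add, Multiset.count_cons_self, Multiset.card_add]
            omega
          · rw [Multiset.cons_add, Multiset.filter_cons_of_neg _ (by simp), Multiset.sum_add]
            simp only [Multiset.filter_add]
            abel
        · rw [substOn_of_notMem (by simpa using h)] at hu
          obtain rfl := Set.mem_singleton_iff.1 hu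
          refine ⟨Q, hQ, ?_, ?_⟩
          · rw [Multiset.count_cons_of_ne (Ne.symm h), hc]
          · rw [Multiset.cons_add, Multiset.filter_cons_of_pos (p := (· ≠ a)) _ h, Multiset.singleton_add]
    refine ⟨k ::ₘ Q, ?_, ?_, by rw [Multiset.sum_cons]⟩
    · intro k' hk'
      rcases Multiset.mem_cons.1 hk' with rfl | hk'
      exacts [hk, hQ k' hk']
    · rw [Multiset.sum_cons, Multiset.count_add, Multiset.card_cons]
      omega
  · rintro Y hY x ⟨Q, hQ, hc, rfl⟩
    let σ : I → Set (Multiset I) := substOn {a} fun _ => Y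
    have hQ' : ∀ k ∈ Q, (k.map σ).sum ⊆ Y := fun k hk z hz =>
      hY (mem_substitute.2 ⟨k, hQ k hk, hz⟩)
    clear hQ
    induction hn : Q.card generalizing Q with
    | zero => omega
    | succ n ih =>
      rcases Nat.eq_zero_or_pos n with rfl | hpos
      · obtain ⟨k, rfl⟩ := Multiset.card_eq_one.1 hn
        simp only [Multiset.sum_singleton, Multiset.card_singleton, Nat.add_eq_right] at hc ⊢
        refine hQ' k (Multiset.mem_singleton_self k) ?_
        clear hn hQ'
        induction k using Multiset.induction with
        | empty => simp
        | cons i k ihk =>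
          have hi : i ≠ a := by
            rintro rfl
            simp at hc
          rw [Multiset.count_cons_of_ne (Ne.symm hi)] at hc
          rw [Multiset.filter_cons_of_pos (p := (· ≠ a)) _ hi, Multiset.map_cons, Multiset.sum_cons,
            ← Multiset.singleton_add]
          refine Set.add_mem_add ?_ (ihk hc)
          rw [show σ i = {{i}} from substOn_of_notMem (by simpa using hi) _]
          rfl
      -- With at least two nodes some `k` contains `a`. Another node `l` is grafted there, which
      -- merges both into the single node `k' + l`. The set `Y` is closed under the merged rule
      -- because it is closed under both.
      · have ha : a ∈ Q.sum := Multiset.count_pos.1 (by omega)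
        obtain ⟨k, hk, hak⟩ := Multiset.mem_join.1 ha
        obtain ⟨R, rfl⟩ := Multiset.exists_cons_of_mem hk
        obtain ⟨k', rfl⟩ := Multiset.exists_cons_of_mem hak
        rw [Multiset.card_cons] at hn
        obtain ⟨l, hl⟩ := Multiset.card_pos_iff_exists_mem.1 (show 0 < R.card by omega)
        obtain ⟨R', rfl⟩ := Multiset.exists_cons_of_mem hl
        have h1 := hQ' _ (Multiset.mem_cons_self _ _)
        have h2 := hQ' l (by simp)
        have := ih ((k' + l) ::ₘ R') ?_ ?_ ?_
        · convert this using 1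
          simp only [Multiset.sum_cons, Multiset.cons_add, Multiset.filter_add]
          rw [Multiset.filter_cons_of_neg _ (by simp), Multiset.filter_add, Multiset.filter_add]
          abel
        · simp only [Multiset.sum_cons, Multiset.count_add, Multiset.count_cons_self,
            Multiset.card_cons] at hc ⊢
          omega
        · intro j hj
          rcases Multiset.mem_cons.1 hj with rfl | hj
          · rw [Multiset.map_add, Multiset.sum_add]
            rw [Multiset.map_cons, Multiset.sum_cons,
              show σ a = Y from substOn_of_mem (Set.mem_singleton a) _, add_comm] at h1
            exact (Set.add_subset_add_left h2).trans h1
          · exact hQ' j (by simp [hj])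
        · rw [Multiset.card_cons] at hn ⊢
          omega

/-- The bound for the elimination of one unknown from a system of equations. -/
def eliminationBound (m : ℕ) : ℕ := m + substituteBound (m + fixpointBound m + 1)

theorem le_eliminationBound (m : ℕ) : m ≤ eliminationBound m := Nat.le_add_right _ _

/-- Parikh's theorem, for systems of equations with semilinear right-hand sides: the least solution
of such a system is semilinear, with an explicit bound. -/
theorem exists_least_solution [Finite I] (U : Finset I) {m : ℕ} (hI : Nat.card I ≤ m)
    (K : I → Set (Multiset I)) (hK : ∀ i, BoundedSemilinear m (K i)) :
    ∃ X : I → Set (Multiset I),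
      (∀ i ∈ U, BoundedSemilinear (eliminationBound^[2 * U.card] m) (X i)) ∧
      (∀ i ∈ U, substitute (substOn U X) (K i) ⊆ X i) ∧
      ∀ Y : I → Set (Multiset I), (∀ i ∈ U, substitute (substOn U Y) (K i) ⊆ Y i) →
        ∀ i ∈ U, X i ⊆ Y i := by
  classical
  induction U using Finset.induction generalizing m K with
  | empty => exact ⟨K, by simp, by simp, by simp⟩
  | insert a U ha ih =>
    -- Gaussian elimination: the equation for `a` is solved with the other unknowns kept as symbols,
    -- and `S` is then substituted into the remaining equations.
    obtain ⟨S, hS, hSclosed, hSleast⟩ := (hK a).exists_fixpoint hI a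
    set M := eliminationBound m with hM
    have hmM : m ≤ M := le_eliminationBound m
    let τ : I → Set (Multiset I) := substOn {a} fun _ => S
    have hτ : ∀ i, BoundedSemilinear (m + fixpointBound m + 1) (τ i) := by
      intro i
      by_cases h : i ∈ ({a} : Set I)
      · simp only [τ]
        rw [substOn_of_mem h]
        exact hS.mono (by omega)
      · simp only [τ]
        rw [substOn_of_notMem h]
        exact BoundedSemilinear.singleton (by simp)
    have hK' : ∀ i, BoundedSemilinear M (substitute τ (K i)) := fun i =>
      (((hK i).mono (show m ≤ m + fixpointBound m + 1 by omega)).substitution (by omega) hτ).mono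
        (by rw [hM, eliminationBound]; omega)
    obtain ⟨X', hX', hclosed, hleast⟩ := ih (hI.trans hmM) (fun i => substitute τ (K i)) hK'
    -- Each unknown costs two applications of the bound, one for its elimination and one for the
    -- back substitution.
    have hcard : eliminationBound^[2 * (insert a U).card] m
        = eliminationBound (eliminationBound^[2 * U.card] M) := by
      rw [Finset.card_insert_of_notMem ha, hM, show 2 * (U.card + 1) = 2 * U.card + 1 + 1 by ring,
        Function.iterate_succ_apply', Function.iterate_succ_apply]
    set M' := eliminationBound^[2 * U.card] M with hM'
    have hMM' : M ≤ M' := Function.id_le_iterate_of_id_le le_eliminationBound _ M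
    let X : I → Set (Multiset I) := fun i => if i = a then substitute (substOn U X') S else X' i
    have hXa : X a = substitute (substOn U X') S := if_pos rfl
    have hXU : ∀ i ∈ U, X i = X' i := fun i hi => if_neg (by rintro rfl; exact ha hi)
    have hcomp : ∀ Y : I → Set (Multiset I), ∀ Z : Set (Multiset I),
        substitute (substOn U Y) Z ⊆ Y a → ∀ i,
        substitute (substOn U Y) (substOn {a} (fun _ => Z) i) ⊆ substOn (insert a U : Finset I) Y i := by
      intro Y Z hZ i
      by_cases h : i = a
      · subst h
        rwa [substOn_of_mem (Set.mem_singleton i), substOn_of_mem (by simp)]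
      · rw [substOn_of_notMem (by simpa using h), substitute_singleton]
        by_cases hi : i ∈ U
        · rw [substOn_of_mem (by simpa using hi), substOn_of_mem (by simp [hi])]
        · rw [substOn_of_notMem (by simpa using hi), substOn_of_notMem (by simp [hi, h])]
    have hcompX : ∀ i, substOn (insert a U : Finset I) X i ⊆
        substitute (substOn U X') (τ i) := by
      intro i
      simp only [τ]
      by_cases h : i = a
      · subst h
        rw [substOn_of_mem (Set.mem_singleton i), substOn_of_mem (by simp), hXa]
      · rw [substOn_of_notMem (show i ∉ ({a} : Set I) by simpa using h), substitute_singleton]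
        by_cases hi : i ∈ U
        · rw [substOn_of_mem (by simp [hi]), substOn_of_mem (by simpa using hi), hXU i hi]
        · rw [substOn_of_notMem (by simp [hi, h]), substOn_of_notMem (by simpa using hi)]
    refine ⟨X, ?_, ?_, ?_⟩
    · intro i hi
      rw [hcard]
      rcases Finset.mem_insert.1 hi with rfl | hi
      · rw [hXa]
        have hS' : BoundedSemilinear (M' + fixpointBound M' + 1) S := by
          refine hS.mono ?_
          have : fixpointBound m ≤ M := by
            have h2 : ∀ n, n ≤ substituteBound n := fun n => by
              unfold substituteBound
              rcases Nat.eq_zero_or_pos n with rfl | hn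
              · exact Nat.zero_le _
              · exact (Nat.le_mul_of_pos_left n hn).trans (Nat.le_add_right _ _)
            have := h2 (m + fixpointBound m + 1)
            rw [hM, eliminationBound]
            omega
          omega
        refine BoundedSemilinear.mono (B := substituteBound (M' + fixpointBound M' + 1))
          (BoundedSemilinear.substitution ?_ hS' ?_) ?_
        · omega
        · intro j
          by_cases hj : j ∈ U
          · rw [substOn_of_mem (by simpa using hj)]
            exact (hX' j hj).mono (by omega)
          · rw [substOn_of_notMem (by simpa using hj)]
            exact BoundedSemilinear.singleton (by simp)
        · rw [eliminationBound]; omega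
      · rw [hXU i hi]
        exact (hX' i hi).mono (le_eliminationBound _)
    · intro i hi
      refine (substitute_subset_substitute hcompX Set.Subset.rfl).trans ?_
      rw [← substitute_substitute]
      rcases Finset.mem_insert.1 hi with rfl | hi
      · rw [hXa]
        exact substitute_subset_substitute (fun _ => Set.Subset.rfl) hSclosed
      · rw [hXU i hi]
        exact hclosed i hi
    · intro Y hY
      have hSY : substitute (substOn U Y) S ⊆ Y a := by
        -- The multisets whose substitution by `Y` lies in `Y a` satisfy the equation for `a` with
        -- the other unknowns as symbols, so minimality of `S` applies to them.
        have hZ : S ⊆ {s | (s.map (substOn U Y)).sum ⊆ Y a} := by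
          have hZ' : substitute (substOn U Y) {s | (s.map (substOn U Y)).sum ⊆ Y a} ⊆ Y a := by
            intro x hx
            obtain ⟨s, hs, hx⟩ := mem_substitute.1 hx
            exact hs hx
          refine hSleast _ fun z hz x hx => hY a (Finset.mem_insert_self a U) ?_
          refine substitute_subset_substitute (hcomp Y _ hZ') Set.Subset.rfl ?_
          rw [← substitute_substitute]
          exact mem_substitute.2 ⟨z, hz, hx⟩
        intro x hx
        obtain ⟨s, hs, hx⟩ := mem_substitute.1 hx
        exact hZ hs hx
      have hX'Y : ∀ i ∈ U, X' i ⊆ Y i := by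
        refine hleast Y fun i hi => ?_
        rw [substitute_substitute]
        exact (substitute_subset_substitute (hcomp Y S hSY) Set.Subset.rfl).trans
          (hY i (Finset.mem_insert_of_mem hi))
      intro i hi
      rcases Finset.mem_insert.1 hi with rfl | hi
      · rw [hXa]
        refine (substitute_subset_substitute (fun j => ?_) Set.Subset.rfl).trans hSY
        by_cases hj : j ∈ U
        · rw [substOn_of_mem (by simpa using hj), substOn_of_mem (by simpa using hj)]
          exact hX'Y j hj
        · rw [substOn_of_notMem (by simpa using hj), substOn_of_notMem (by simpa using hj)]
      · rw [hXU i hi]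
        exact hX'Y i hi

end Fixpoint

/-! ### The bounds are primitive recursive -/

section PrimrecBounds

theorem primrec₂_pow : Primrec₂ fun a b : ℕ => a ^ b := Primrec₂.unpaired'.1 Nat.Primrec.pow

theorem primrec_starBound : Primrec starBound := by
  have h : Primrec fun m : ℕ => (m + 1) ^ m := primrec₂_pow.comp Primrec.succ Primrec.id
  exact Primrec.nat_mul.comp (Primrec.nat_mul.comp h (primrec₂_pow.comp (Primrec.const 2) h))
    Primrec.id

theorem primrec_hyperplaneBound : Primrec hyperplaneBound := by
  have h : Primrec fun m : ℕ => m + m * m :=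
    Primrec.nat_add.comp Primrec.id (Primrec.nat_mul.comp Primrec.id Primrec.id)
  exact Primrec.nat_add.comp Primrec.id (Primrec.nat_mul.comp
    (Primrec.succ.comp (Primrec.nat_mul.comp (Primrec.const 2) h)) Primrec.id)

theorem primrec_eliminationBound : Primrec eliminationBound := by
  have hs : Primrec substituteBound := by
    have h : Primrec fun m : ℕ => m * m := Primrec.nat_mul.comp Primrec.id Primrec.id
    exact Primrec.nat_add.comp h
      (primrec_starBound.comp (Primrec.nat_add.comp Primrec.id h))
  have hf : Primrec fixpointBound :=
    primrec_hyperplaneBound.comp (Primrec.succ.comp (primrec_starBound.comp Primrec.succ))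
  exact Primrec.nat_add.comp Primrec.id
    (hs.comp (Primrec.succ.comp (Primrec.nat_add.comp Primrec.id hf)))

/-- The bound for the least solution of a system of equations. -/
def solutionBound (m : ℕ) : ℕ := eliminationBound^[2 * m] m

theorem primrec_solutionBound : Primrec solutionBound :=
  Primrec.nat_iterate (Primrec.nat_mul.comp (Primrec.const 2) Primrec.id) Primrec.id
    (primrec_eliminationBound.comp Primrec.snd)

theorem iterate_le_solutionBound {m n : ℕ} (h : n ≤ m) :
    eliminationBound^[2 * n] m ≤ solutionBound m :=
  Function.monotone_iterate_of_id_le le_eliminationBound (by omega) m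

end PrimrecBounds

/-! ### Runs in labelled graphs and Parikh boundedness -/

/-- `Run src tgt lab p q g x`: in the labelled graph with the given source, target and label
functions there is a path from `p` to `q` whose product of labels is `g` and whose multiset of
edges is `x`. -/
inductive Run {V E G : Type*} [Monoid G] (src tgt : E → V) (lab : E → G) :
    V → V → G → Multiset E → Prop
  | nil (p : V) : Run src tgt lab p p 1 0
  | cons (e : E) {q : V} {g : G} {x : Multiset E} :
      Run src tgt lab (tgt e) q g x → Run src tgt lab (src e) q (lab e * g) (e ::ₘ x)

namespace Run

variable {V E G : Type*} [Monoid G] {src tgt : E → V} {lab : E → G}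

theorem cast {p p' q q' : V} {g g' : G} {x x' : Multiset E} (h : Run src tgt lab p q g x)
    (hp : p = p') (hq : q = q') (hg : g = g') (hx : x = x') : Run src tgt lab p' q' g' x' := by
  subst hp hq hg hx
  exact h

theorem append {p q r : V} {g h : G} {x y : Multiset E} (h₁ : Run src tgt lab p q g x)
    (h₂ : Run src tgt lab q r h y) : Run src tgt lab p r (g * h) (x + y) := by
  induction h₁ with
  | nil p => simpa using h₂
  | cons e _ ih =>
    rw [mul_assoc, Multiset.cons_add]
    exact cons e (ih h₂)

theorem single (e : E) : Run src tgt lab (src e) (tgt e) (lab e) {e} :=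
  (cons e (nil (tgt e))).cast rfl rfl (mul_one _) rfl

theorem map {V' E' G' : Type*} [Monoid G'] {src' tgt' : E' → V'} {lab' : E' → G'}
    (fV : V → V') (fE : E → E') (φ : G →* G') (hs : ∀ e, src' (fE e) = fV (src e))
    (ht : ∀ e, tgt' (fE e) = fV (tgt e)) (hl : ∀ e, lab' (fE e) = φ (lab e))
    {p q : V} {g : G} {x : Multiset E} (h : Run src tgt lab p q g x) :
    Run src' tgt' lab' (fV p) (fV q) (φ g) (x.map fE) := by
  induction h with
  | nil p => simpa using nil (fV p)
  | cons e _ ih =>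
    rw [Multiset.map_cons, map_mul, ← hl, ← hs]
    refine cons _ ?_
    rw [ht]
    exact ih

theorem exists_of_comp {G' : Type*} [Monoid G'] (φ : G →* G') {p q : V} {h : G'} {x : Multiset E}
    (hr : Run src tgt (fun e => φ (lab e)) p q h x) :
    ∃ g, φ g = h ∧ Run src tgt lab p q g x := by
  induction hr with
  | nil p => exact ⟨1, map_one φ, nil p⟩
  | cons e _ ih =>
    obtain ⟨g, rfl, hg⟩ := ih
    exact ⟨lab e * g, map_mul φ _ _, cons e hg⟩

end Run

/-- The edge multisets of closed runs in finite graphs with labels in `Y` form semilinear sets,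
with a primitive recursive bound in terms of the size of the graph. -/
def ParikhBoundedOn {G : Type*} [Monoid G] (Y : Set G) : Prop :=
  ∃ F : ℕ → ℕ, Primrec F ∧ ∀ (m : ℕ) (V E : Type) [Finite V] [Finite E] (src tgt : E → V)
    (lab : E → G), Nat.card V ≤ m → Nat.card E ≤ m → (∀ e, lab e ∈ Y) → ∀ p q,
    BoundedSemilinear (F m) {x | Run src tgt lab p q 1 x}

/-- `ParikhBoundedOn` for all finite sets of labels. -/
def ParikhBounded (G : Type*) [Monoid G] : Prop :=
  ∀ Y : Set G, Y.Finite → ParikhBoundedOn Y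

theorem ParikhBoundedOn.mono {G : Type*} [Monoid G] {Y Z : Set G} (h : ParikhBoundedOn Z)
    (hYZ : Y ⊆ Z) : ParikhBoundedOn Y := by
  obtain ⟨F, hF, h⟩ := h
  exact ⟨F, hF, fun m V E _ _ src tgt lab hV hE hY =>
    h m V E src tgt lab hV hE fun e => hYZ (hY e)⟩

/-- An injective homomorphism reflects the value `1`, so relabelling the edges by their images
leaves the set of value-one runs unchanged. -/
theorem ParikhBounded.of_injective {G H : Type*} [Monoid G] [Monoid H] (hH : ParikhBounded H)
    (φ : G →* H) (hφ : Function.Injective φ) : ParikhBounded G := by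
  intro Y hY
  obtain ⟨F, hF, h⟩ := hH (φ '' Y) (hY.image φ)
  refine ⟨F, hF, fun m V E _ _ src tgt lab hV hE hYe p q => ?_⟩
  have := h m V E src tgt (fun e => φ (lab e)) hV hE (fun e => ⟨_, hYe e, rfl⟩) p q
  convert this using 1
  ext x
  constructor
  · intro hx
    exact (Run.map (src' := src) (tgt' := tgt) (lab' := fun e => φ (lab e)) id id φ (fun _ => rfl)
      (fun _ => rfl) (fun _ => rfl) hx).cast rfl rfl (map_one φ) (Multiset.map_id x)
  · intro hx
    obtain ⟨g, hg, hr⟩ := Run.exists_of_comp φ hx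
    exact hr.cast rfl rfl (hφ (hg.trans (map_one φ).symm)) rfl

/-- The multisets of the left summands in a multiset. -/
def Multiset.lefts {A B : Type*} : Multiset (A ⊕ B) →+ Multiset A where
  toFun := Multiset.filterMap Sum.getLeft?
  map_zero' := rfl
  map_add' := Multiset.filterMap_add _

namespace Multiset

variable {A B : Type*}

@[simp] theorem lefts_cons_inl (a : A) (x : Multiset (A ⊕ B)) :
    lefts (Sum.inl a ::ₘ x) = a ::ₘ lefts x :=
  filterMap_cons_some _ _ _ rfl

@[simp] theorem lefts_cons_inr (b : B) (x : Multiset (A ⊕ B)) :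
    lefts (Sum.inr b ::ₘ x) = lefts x :=
  filterMap_cons_none _ _ rfl

@[simp] theorem lefts_map_inl (x : Multiset A) : lefts (x.map (Sum.inl : A → A ⊕ B)) = x := by
  induction x using Multiset.induction with
  | empty => rfl
  | cons a x ih => simp [ih]

@[simp] theorem lefts_map_inr (x : Multiset B) : lefts (x.map (Sum.inr : B → A ⊕ B)) = 0 := by
  induction x using Multiset.induction with
  | empty => rfl
  | cons a x ih => simp [ih]

theorem card_lefts_le (x : Multiset (A ⊕ B)) : (lefts x).card ≤ x.card := by
  induction x using Multiset.induction with
  | empty => rfl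
  | cons a x ih =>
    rcases a with a | b
    · simpa using ih
    · simpa using ih.trans (Nat.le_succ _)

end Multiset

/-! ### Subdividing edges, and reduction to a generating set -/

section Splitting

variable {V E G : Type*} [Monoid G] {src tgt : E → V} {lab a b : E → G}

/-- Every edge `e` is subdivided at a midpoint `Sum.inr e`, with labels `a e` and `b e` on its
halves. -/
theorem Run.split (hab : ∀ e, a e * b e = lab e) {p q : V} {g : G} {x : Multiset E}
    (h : Run src tgt lab p q g x) :
    Run (Sum.elim (fun e => Sum.inl (src e)) Sum.inr) (Sum.elim Sum.inr fun e => Sum.inl (tgt e))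
      (Sum.elim a b) (Sum.inl p) (Sum.inl q) g (x.map Sum.inl + x.map Sum.inr) := by
  induction h with
  | nil p => exact Run.nil _
  | cons e _ ih =>
    refine (Run.cons (Sum.inl e) (Run.cons (Sum.inr e) ih)).cast rfl rfl ?_ ?_
    · simp [← hab, mul_assoc]
    · simp only [Multiset.map_cons, Multiset.cons_add, Multiset.add_cons]
      exact Multiset.cons_swap _ _ _

/-- A midpoint has only one outgoing edge, so halves occur in pairs, except for a second half at the
start; the induction treats both kinds of starting point. Counting first halves recovers the edges.
-/
theorem Run.of_split (hab : ∀ e, a e * b e = lab e) {P Q : V ⊕ E} {g : G} {y : Multiset (E ⊕ E)}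
    (h : Run (Sum.elim (fun e => Sum.inl (src e)) Sum.inr)
      (Sum.elim Sum.inr fun e => Sum.inl (tgt e)) (Sum.elim a b) P Q g y) :
    ∀ q, Q = Sum.inl q → (∀ p, P = Sum.inl p → Run src tgt lab p q g y.lefts) ∧
      ∀ e, P = Sum.inr e → ∃ h, Run src tgt lab (tgt e) q h y.lefts ∧ g = b e * h := by
  induction h with
  | nil p =>
    rintro q rfl
    refine ⟨fun p hp => ?_, fun e he => by cases he⟩
    cases hp
    exact Run.nil _
  | cons e _ ih =>
    intro q hq
    obtain ⟨h1, h2⟩ := ih q hq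
    rcases e with e | e
    · refine ⟨fun p hp => ?_, fun e he => by cases he⟩
      obtain ⟨h, hr, rfl⟩ := h2 e rfl
      cases hp
      exact (Run.cons e hr).cast rfl rfl (by simp [← hab, mul_assoc]) (by simp)
    · refine ⟨fun p hp => (by cases hp), fun e' he => ?_⟩
      cases he
      exact ⟨_, by simpa using h1 (tgt e) rfl, rfl⟩

end Splitting

theorem ParikhBoundedOn.mul {G : Type*} [Monoid G] {Y Z : Set G} (h : ParikhBoundedOn (Y ∪ Z)) :
    ParikhBoundedOn (Y * Z) := by
  obtain ⟨F, hF, h⟩ := h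
  refine ⟨fun m => F (2 * m), hF.comp (Primrec.nat_mul.comp (Primrec.const 2) Primrec.id),
    fun m V E _ _ src tgt lab hV hE hYe p q => ?_⟩
  have hYe' : ∀ e, ∃ a b, a ∈ Y ∧ b ∈ Z ∧ a * b = lab e := fun e => by
    obtain ⟨a, ha, b, hb, hab⟩ := Set.mem_mul.1 (hYe e)
    exact ⟨a, b, ha, hb, hab⟩
  choose a b ha hb hab using hYe'
  have := h (2 * m) (V ⊕ E) (E ⊕ E) (Sum.elim (fun e => Sum.inl (src e)) Sum.inr)
    (Sum.elim Sum.inr fun e => Sum.inl (tgt e)) (Sum.elim a b) (by rw [Nat.card_sum]; omega)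
    (by rw [Nat.card_sum]; omega)
    (by rintro (e | e); exacts [Or.inl (ha e), Or.inr (hb e)]) (Sum.inl p) (Sum.inl q)
  convert this.image Multiset.lefts Multiset.card_lefts_le using 1
  ext x
  constructor
  · intro hx
    exact ⟨_, Run.split hab hx, by simp⟩
  · rintro ⟨y, hy, rfl⟩
    exact (Run.of_split hab hy q rfl).1 p rfl

theorem ParikhBoundedOn.pow {G : Type*} [Monoid G] {Y : Set G} (h : ParikhBoundedOn Y) (k : ℕ) :
    ParikhBoundedOn (Y ^ 2 ^ k) := by
  induction k with
  | zero => simpa using h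
  | succ k ih =>
    rw [pow_succ, mul_two, pow_add]
    exact ParikhBoundedOn.mul (by rwa [Set.union_self])

/-- It suffices to consider labels from a generating set. -/
theorem ParikhBounded.of_closure_eq_top {G : Type*} [Monoid G] {S : Set G}
    (hS : Submonoid.closure S = ⊤) (h : ∀ Y : Set G, Y.Finite → Y ⊆ S ∪ {1} → ParikhBoundedOn Y) :
    ParikhBounded G := by
  have key : ∀ z : G, ∃ (n : ℕ) (Y : Set G), Y.Finite ∧ Y ⊆ S ∪ {1} ∧ 1 ∈ Y ∧ z ∈ Y ^ n := by
    intro z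
    have hz : z ∈ Submonoid.closure S := hS ▸ Submonoid.mem_top z
    induction hz using Submonoid.closure_induction with
    | mem z hz =>
      exact ⟨1, {z, 1}, by simp, by rintro y (rfl | rfl); exacts [Or.inl hz, Or.inr rfl],
        by simp, by simp⟩
    | one => exact ⟨0, {1}, by simp, by simp, by simp, by simp⟩
    | mul u v _ _ hu hv =>
      obtain ⟨n, Y, hY, hYS, hY1, huY⟩ := hu
      obtain ⟨k, Z, hZ, hZS, hZ1, hvZ⟩ := hv
      refine ⟨n + k, Y ∪ Z, hY.union hZ, Set.union_subset hYS hZS, Or.inl hY1, ?_⟩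
      rw [pow_add]
      exact Set.mul_mem_mul (Set.pow_subset_pow_left Set.subset_union_left huY)
        (Set.pow_subset_pow_left Set.subset_union_right hvZ)
  intro Z hZ
  obtain ⟨n, Y, hY, hYS, hZY⟩ : ∃ (n : ℕ) (Y : Set G), Y.Finite ∧ (Y ⊆ S ∪ {1} ∧ 1 ∈ Y) ∧
      Z ⊆ Y ^ n := by
    induction Z, hZ using Set.Finite.induction_on with
    | empty => exact ⟨0, {1}, by simp, by simp, by simp⟩
    | @insert z Z _ _ ih =>
      obtain ⟨n, Y, hY, ⟨hYS, hY1⟩, hZY⟩ := ih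
      obtain ⟨k, Y', hY', hYS', hY1', hzY⟩ := key z
      refine ⟨n + k, Y ∪ Y', hY.union hY', ⟨Set.union_subset hYS hYS', Or.inl hY1⟩, ?_⟩
      rintro y (rfl | hy)
      · exact Set.pow_subset_pow Set.subset_union_right (Or.inl hY1) (Nat.le_add_left _ _) hzY
      · exact Set.pow_subset_pow Set.subset_union_left (Or.inl hY1) (Nat.le_add_right _ _) (hZY hy)
  -- Since `1 ∈ Y`, the powers of `Y` increase, so the exponent `n` can be raised to `2 ^ n`.
  exact ((h Y hY hYS.1).pow n).mono
    (hZY.trans (Set.pow_subset_pow_right hYS.2 Nat.lt_two_pow_self.le))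

/-! ### The trivial group -/

/-- Parikh's theorem for regular languages. -/
theorem ParikhBounded.of_subsingleton {G : Type*} [Monoid G] [Subsingleton G] :
    ParikhBounded G := by
  classical
  intro Y _
  refine ⟨fun m => solutionBound (2 * m + 2), primrec_solutionBound.comp (Primrec.succ.comp
    (Primrec.succ.comp (Primrec.nat_mul.comp (Primrec.const 2) Primrec.id))),
    fun m V E _ _ src tgt lab hV hE _ p q => ?_⟩
  have := Fintype.ofFinite V
  let U : Finset (E ⊕ V) := Finset.univ.map Function.Embedding.inr
  have hU : ∀ p : V, Sum.inr p ∈ U := fun p => by simp [U]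
  have hUl : ∀ e : E, Sum.inl e ∉ (U : Set (E ⊕ V)) := fun e => by simp [U]
  -- The right-linear grammar of the graph: edges are terminals and vertices are unknowns. The value
  -- at a terminal plays no role, since terminals are not in `U`.
  let K : E ⊕ V → Set (Multiset (E ⊕ V)) := Sum.elim (fun _ => ∅) fun p =>
    {x | (p = q ∧ x = 0) ∨ ∃ e, src e = p ∧ x = {Sum.inl e, Sum.inr (tgt e)}}
  have hK : ∀ i, BoundedSemilinear (2 * m + 2) (K i) := by
    rintro (e | p)
    · intro x hx
      exact hx.elim
    · refine BoundedSemilinear.of_forall_exists_subset fun x hx =>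
        ⟨{x}, rfl, Set.singleton_subset_iff.2 hx, BoundedSemilinear.singleton ?_⟩
      rcases hx with ⟨-, rfl⟩ | ⟨e, -, rfl⟩ <;> simp
  obtain ⟨X, hX, hclosed, hleast⟩ := exists_least_solution U
    (show Nat.card (E ⊕ V) ≤ 2 * m + 2 by rw [Nat.card_sum]; omega) K hK
  have hcard : U.card ≤ 2 * m + 2 := by
    rw [Finset.card_map, Finset.card_univ, ← Nat.card_eq_fintype_card]
    omega
  have hXp := (((hX _ (hU p)).mono (iterate_le_solutionBound hcard)).image Multiset.lefts
    Multiset.card_lefts_le)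
  convert hXp using 1
  ext x
  constructor
  · intro hx
    refine ⟨x.map Sum.inl, ?_, by simp⟩
    clear hXp
    have : ∀ p q' g x, Run src tgt lab p q' g x → q' = q → x.map Sum.inl ∈ X (Sum.inr p) := by
      intro p q' g x hx
      induction hx with
      | nil p =>
        rintro rfl
        refine hclosed _ (hU p) (mem_substitute.2 ⟨0, Or.inl ⟨rfl, rfl⟩, by simp⟩)
      | cons e _ ih =>
        intro hq
        refine hclosed _ (hU _) (mem_substitute.2 ⟨{Sum.inl e, Sum.inr (tgt e)},
          Or.inr ⟨e, rfl, rfl⟩, ?_⟩)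
        simp only [Multiset.insert_eq_cons, Multiset.map_cons, Multiset.map_singleton,
          Multiset.sum_cons, Multiset.sum_singleton]
        rw [substOn_of_notMem (hUl e), substOn_of_mem (by simpa using hU _),
          ← Multiset.singleton_add]
        exact Set.add_mem_add rfl (ih hq)
    exact this p q 1 x hx rfl
  · rintro ⟨y, hy, rfl⟩
    have := hleast (Sum.elim (fun _ => ∅) fun p => Multiset.map Sum.inl '' {x | Run src tgt lab p q 1 x})
      ?_ (Sum.inr p) (hU p) hy
    · obtain ⟨x, hx, rfl⟩ := this
      simpa using hx
    · rintro (e | p) hi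
      · exact absurd hi (hUl e)
      · intro x hx
        obtain ⟨k, hk, hx⟩ := mem_substitute.1 hx
        rcases hk with ⟨rfl, rfl⟩ | ⟨e, rfl, rfl⟩
        · simp only [Multiset.map_zero, Multiset.sum_zero, Set.mem_zero] at hx
          subst hx
          exact ⟨0, Run.nil _, rfl⟩
        · simp only [Multiset.insert_eq_cons, Multiset.map_cons, Multiset.map_singleton,
            Multiset.sum_cons, Multiset.sum_singleton] at hx
          rw [substOn_of_notMem (hUl e), substOn_of_mem (by simpa using hU _)] at hx
          obtain ⟨u, hu, v, ⟨w, hw, rfl⟩, rfl⟩ := Set.mem_add.1 hx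
          obtain rfl := Set.mem_singleton_iff.1 hu
          exact ⟨e ::ₘ w, (Run.cons e hw).cast rfl rfl (Subsingleton.elim _ _) rfl, by
            rw [Multiset.map_cons, Multiset.singleton_add]⟩

/-! ### Semidirect products with the integers acting through a finite group -/

section Semidirect

variable {N A : Type*} [Group N] [Group A] (ψ : A →* MulAut N) (π : Multiplicative ℤ →* A)
  {V E : Type*} {src tgt : E → V} {lab : E → N ⋊[ψ.comp π] Multiplicative ℤ}

/-- The second coordinate of a vertex stores the element of `A` by which the labels read so far act,
so the label of an edge can be the twisted `N`-component. The product of these labels is then the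
`N`-component of the value. -/
theorem Run.semidirect_lift {p q : V} {g : N ⋊[ψ.comp π] Multiplicative ℤ} {x : Multiset E}
    (h : Run src tgt lab p q g x) (a : A) :
    ∃ y : Multiset (E × A), y.map Prod.fst = x ∧
      Run (fun e : E × A => (src e.1, e.2)) (fun e => (tgt e.1, e.2 * π (lab e.1).right))
        (fun e => ψ e.2 (lab e.1).left) (p, a) (q, a * π g.right) (ψ a g.left) y := by
  induction h generalizing a with
  | nil p => exact ⟨0, rfl, (Run.nil _).cast rfl (by simp) (by simp) rfl⟩
  | cons e _ ih =>
    obtain ⟨y, rfl, hy⟩ := ih (a * π (lab e).right)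
    refine ⟨(e, a) ::ₘ y, by simp, ?_⟩
    have := Run.cons (src := fun e : E × A => (src e.1, e.2))
      (tgt := fun e => (tgt e.1, e.2 * π (lab e.1).right))
      (lab := fun e => ψ e.2 (lab e.1).left) (e, a) hy
    exact this.cast rfl (by simp [mul_assoc]) (by simp) rfl

theorem Run.semidirect_proj {P Q : V × A} {n : N} {y : Multiset (E × A)}
    (h : Run (fun e : E × A => (src e.1, e.2)) (fun e => (tgt e.1, e.2 * π (lab e.1).right))
        (fun e => ψ e.2 (lab e.1).left) P Q n y) :
    ∃ g, Run src tgt lab P.1 Q.1 g (y.map Prod.fst) ∧ ψ P.2 g.left = n := by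
  induction h with
  | nil p => exact ⟨1, Run.nil _, by simp⟩
  | cons e _ ih =>
    obtain ⟨g, hg, rfl⟩ := ih
    refine ⟨lab e.1 * g, ?_, by simp⟩
    rw [Multiset.map_cons]
    exact Run.cons _ hg

theorem Run.sum_right {p q : V} {g : N ⋊[ψ.comp π] Multiplicative ℤ} {x : Multiset E}
    (h : Run src tgt lab p q g x) :
    (x.map fun e => (lab e).right.toAdd).sum = g.right.toAdd := by
  induction h with
  | nil p => simp
  | cons e _ ih => simp [ih]

end Semidirect

theorem ParikhBounded.semidirectProduct {N : Type*} {A : Type} [Group N] [Group A] [Finite A]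
    (ψ : A →* MulAut N) (π : Multiplicative ℤ →* A) (hN : ParikhBounded N) :
    ParikhBounded (N ⋊[ψ.comp π] Multiplicative ℤ) := by
  intro Y hY
  obtain ⟨F, hF, h⟩ := hN (⋃ a : A, (fun y => ψ a y.left) '' Y)
    (Set.finite_iUnion fun a => hY.image _)
  -- The exponents in `ℤ` are the weights of the hyperplane, so they must be bounded uniformly over
  -- the label set.
  obtain ⟨C, hC⟩ : ∃ C : ℕ, ∀ y ∈ Y, |y.right.toAdd| ≤ C := by
    obtain ⟨C, hC⟩ := (hY.image fun y => y.right.toAdd.natAbs).bddAbove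
    refine ⟨C, fun y hy => ?_⟩
    rw [Int.abs_eq_natAbs]
    exact_mod_cast hC ⟨y, hy, rfl⟩
  have hFm : Primrec fun m => F (m * Nat.card A) :=
    hF.comp (Primrec.nat_mul.comp Primrec.id (Primrec.const _))
  refine ⟨fun m => hyperplaneBound (F (m * Nat.card A) + C),
    primrec_hyperplaneBound.comp (Primrec.nat_add.comp hFm (Primrec.const C)),
    fun m V E _ _ src tgt lab hV hE hYe p q => ?_⟩
  have h1 := h (m * Nat.card A) (V × A) (E × A) (fun e => (src e.1, e.2))
    (fun e => (tgt e.1, e.2 * π (lab e.1).right)) (fun e => ψ e.2 (lab e.1).left)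
    (by rw [Nat.card_prod]; exact Nat.mul_le_mul_right _ hV)
    (by rw [Nat.card_prod]; exact Nat.mul_le_mul_right _ hE)
    -- The final second coordinate is `1` because a value-one run has trivial `ℤ`-component.
    (fun e => Set.mem_iUnion.2 ⟨e.2, lab e.1, hYe _, rfl⟩) (p, 1) (q, 1)
  have h2 := (h1.mono (Nat.le_add_right _ C)).hyperplane (fun e => (lab e.1).right.toAdd)
    (fun e => (hC _ (hYe _)).trans (by push_cast; omega)) 0 (by simp; omega)
  convert h2.image (Multiset.mapAddMonoidHom Prod.fst) (by simp) using 1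
  ext x
  constructor
  · intro hx
    obtain ⟨y, rfl, hy⟩ := Run.semidirect_lift ψ π hx 1
    refine ⟨y, ⟨hy.cast rfl (by simp) (by simp) rfl, ?_⟩, rfl⟩
    have := Run.sum_right ψ π hx
    simpa using this
  · rintro ⟨y, ⟨hy, hys⟩, rfl⟩
    obtain ⟨g, hg, hg1⟩ := Run.semidirect_proj ψ π hy
    refine hg.cast rfl rfl ?_ rfl
    have := Run.sum_right ψ π hg
    rw [Multiset.map_map] at this
    ext
    · simpa using hg1
    · exact congrArg Multiplicative.ofAdd (this.symm.trans hys)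

/-! ### Free products -/

section FreeProduct

variable {G : Bool → Type u} [∀ i, Group (G i)] {V E : Type}

/-- A path given by blocks, each with a value in one factor of a free product. The relation
`B i p q g z` says that there is a block from `p` to `q` with value `g : G i` and weight `z`. -/
inductive BlockPath {I : Type*} (B : ∀ i : Bool, V → V → G i → Multiset I → Prop) :
    V → V → List (Σ i, G i) → Multiset I → Prop
  | nil (p : V) : BlockPath B p p [] 0
  | cons {i : Bool} {p q r : V} {g : G i} {z : Multiset I} {l : List (Σ i, G i)} {w : Multiset I} :
      B i p q g z → BlockPath B q r l w → BlockPath B p r (⟨i, g⟩ :: l) (z + w)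

/-- The value of a list of elements of the factors. -/
def coprodValue (l : List (Σ i, G i)) : CoprodI G := (l.map fun s => CoprodI.of s.2).prod

@[simp] theorem coprodValue_nil : coprodValue ([] : List (Σ i, G i)) = 1 := rfl

@[simp] theorem coprodValue_cons (s : Σ i, G i) (l : List (Σ i, G i)) :
    coprodValue (s :: l) = CoprodI.of s.2 * coprodValue l := by
  simp [coprodValue]

/-- A list of elements of the factors is reduced if it has no trivial member and no two adjacent
members from the same factor. -/
def IsReducedList (l : List (Σ i, G i)) : Prop :=
  (∀ s ∈ l, s.2 ≠ 1) ∧ l.IsChain fun s t => s.1 ≠ t.1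

/-- This is the normal form theorem for free products: a reduced list is a `CoprodI.Word`, and such
words are determined by their values. -/
theorem IsReducedList.eq_nil {l : List (Σ i, G i)} (h : IsReducedList l)
    (h1 : coprodValue l = 1) : l = [] := by
  classical
  let w : CoprodI.Word G := ⟨l, h.1, h.2⟩
  have hw : w.prod = (CoprodI.Word.empty : CoprodI.Word G).prod := by
    rw [CoprodI.Word.prod_empty]
    exact h1
  exact congrArg CoprodI.Word.toList 
    (CoprodI.Word.equiv.symm.injective (a₁ := w) (a₂ := CoprodI.Word.empty) hw)

variable {I : Type*} {B : ∀ i : Bool, V → V → G i → Multiset I → Prop}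
  {X : V → V → Set (Multiset I)}

/-- A non-reduced path of blocks can be shortened, unless it consists of a single trivial block. -/
theorem BlockPath.shorten
    (happ : ∀ {i p q r g h z w}, B i p q g z → B i q r h w → B i p r (g * h) (z + w))
    (hone : ∀ {i p q z}, B i p q 1 z → z ∈ X p q)
    (hof : ∀ {i p q z}, z ∈ X p q → B i p q 1 z)
    {p q : V} {l : List (Σ i, G i)} {z : Multiset I} (h : BlockPath B p q l z)
    (hl : ¬ IsReducedList l) :
    (z ∈ X p q ∧ coprodValue l = 1) ∨ ∃ l', l'.length < l.length ∧ coprodValue l' = coprodValue l ∧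
      BlockPath B p q l' z := by
  induction h with
  | nil p => exact absurd ⟨by simp, by simp⟩ hl
  | @cons i p q r g z l w hB hP ih =>
    by_cases hg : g = 1
    · subst hg
      cases hP with
      | nil => exact Or.inl ⟨by simpa using hone hB, by simp⟩
      | @cons j _ s _ g' z' l' w' hB' hP' =>
        refine Or.inr ⟨⟨j, g'⟩ :: l', by simp, by simp, ?_⟩
        -- A trivial block is a shortcut, and shortcuts are available in both factors; reread in the
        -- factor `j`, it merges with the next block.
        have := happ (hof (i := j) (hone hB)) hB'
        rw [one_mul] at this
        rw [← add_assoc]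
        exact BlockPath.cons this hP'
    · by_cases hred : IsReducedList l
      · cases hP with
        | nil => exact absurd ⟨by simpa using hg, by simp⟩ hl
        | @cons j _ s _ g' z' l' w' hB' hP' =>
          by_cases hij : i = j
          · subst hij
            refine Or.inr ⟨⟨i, g * g'⟩ :: l', by simp, by simp [mul_assoc], ?_⟩
            rw [← add_assoc]
            exact BlockPath.cons (happ hB hB') hP'
          · refine absurd ⟨?_, ?_⟩ hl
            · intro s hs
              rcases List.mem_cons.1 hs with rfl | hs
              exacts [hg, hred.1 s hs]
            · exact List.isChain_cons_cons.2 ⟨hij, hred.2⟩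
      · rcases ih hred with ⟨hw, hv⟩ | ⟨l', hlen, hval, hP'⟩
        · have hmerge := happ hB (hof (i := i) hw)
          rw [mul_one] at hmerge
          refine Or.inr ⟨[⟨i, g⟩], ?_, by simp [hv], ?_⟩
          · have : 0 < l.length := by
              rw [List.length_pos_iff]
              rintro rfl
              exact hred ⟨by simp, by simp⟩
            simpa using this
          · simpa using BlockPath.cons hmerge (BlockPath.nil r)
        · exact Or.inr ⟨⟨i, g⟩ :: l', by simpa using hlen, by simp [hval],
            BlockPath.cons hB hP'⟩

theorem BlockPath.mem_of_coprodValue_eq_one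
    (happ : ∀ {i p q r g h z w}, B i p q g z → B i q r h w → B i p r (g * h) (z + w))
    (hone : ∀ {i p q z}, B i p q 1 z → z ∈ X p q)
    (hof : ∀ {i p q z}, z ∈ X p q → B i p q 1 z) (hnil : ∀ p, 0 ∈ X p p)
    {p q : V} {l : List (Σ i, G i)} {z : Multiset I} (h : BlockPath B p q l z)
    (hl : coprodValue l = 1) : z ∈ X p q := by
  induction hn : l.length using Nat.strong_induction_on generalizing l with
  | _ n ih =>
    by_cases hred : IsReducedList l
    · obtain rfl := hred.eq_nil hl
      cases h
      exact hnil p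
    · rcases BlockPath.shorten (B := B) (X := X) happ hone hof h hred with ⟨hz, -⟩ | ⟨l', hlen, hval, h'⟩
      · exact hz
      · exact ih l'.length (hn ▸ hlen) h' (hval.trans hl) rfl

variable {src tgt : E → V} {lab : E → CoprodI G}

/-- The edges whose labels lie in the factor `i`. -/
abbrev FactorEdge (lab : E → CoprodI G) (i : Bool) : Type :=
  {e : E // ∃ g : G i, CoprodI.of g = lab e}

/-- The label of an edge, as an element of the factor `i`; the additional edges, given by pairs of
vertices, have trivial labels. -/
noncomputable def factorLabel (lab : E → CoprodI G) (i : Bool) : FactorEdge lab i ⊕ V × V → G i :=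
  Sum.elim (fun e => e.2.choose) fun _ => 1

/-- The runs that use edges with labels in the factor `i` and additional trivial edges. -/
abbrev FactorRun (src tgt : E → V) (lab : E → CoprodI G) (i : Bool) :
    V → V → G i → Multiset (FactorEdge lab i ⊕ V × V) → Prop :=
  Run (Sum.elim (fun e => src e.1) Prod.fst) (Sum.elim (fun e => tgt e.1) Prod.snd)
    (factorLabel lab i)

/-- The right-hand sides of the system of equations for closed runs in a free product. -/
def factorRules (src tgt : E → V) (lab : E → CoprodI G) : E ⊕ V × V → Set (Multiset (E ⊕ V × V)) :=
  Sum.elim (fun _ => ∅) fun p => ⋃ i : Bool,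
    Multiset.mapAddMonoidHom (Sum.map Subtype.val id) '' {k | FactorRun src tgt lab i p.1 p.2 1 k}

/-- Soundness of the rules: replacing each shortcut edge by an actual value-one run with the same
ends does not change the value of a run. -/
theorem run_of_factorRun {i : Bool} {p q : V} {g : G i}
    {k : Multiset (FactorEdge lab i ⊕ V × V)} (h : FactorRun src tgt lab i p q g k)
    {σ : E ⊕ V × V → Set (Multiset (E ⊕ V × V))} (hl : ∀ e, σ (Sum.inl e) = {{Sum.inl e}})
    (hr : ∀ p, σ (Sum.inr p) = Multiset.map Sum.inl '' {x | Run src tgt lab p.1 p.2 1 x}) :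
    ∀ x ∈ ((k.map (Sum.map Subtype.val id)).map σ).sum, ∃ y, y.map Sum.inl = x ∧
      Run src tgt lab p q (CoprodI.of g) y := by
  induction h with
  | nil p =>
    intro x hx
    simp only [Multiset.map_zero, Multiset.sum_zero, Set.mem_zero] at hx
    subst hx
    exact ⟨0, rfl, (Run.nil p).cast rfl rfl (map_one _).symm rfl⟩
  | cons e _ ih =>
    intro x hx
    rw [Multiset.map_cons, Multiset.map_cons, Multiset.sum_cons] at hx
    obtain ⟨u, hu, v, hv, rfl⟩ := Set.mem_add.1 hx
    obtain ⟨y, rfl, hy⟩ := ih v hv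
    rcases e with e | e
    · rw [Sum.map_inl, hl] at hu
      obtain rfl := Set.mem_singleton_iff.1 hu
      refine ⟨e.1 ::ₘ y, by rw [Multiset.map_cons, Multiset.singleton_add], ?_⟩
      refine (Run.cons e.1 hy).cast rfl rfl ?_ rfl
      rw [map_mul, factorLabel, Sum.elim_inl, e.2.choose_spec]
    · rw [Sum.map_inr, hr] at hu
      obtain ⟨u, hu, rfl⟩ := hu
      refine ⟨u + y, by rw [Multiset.map_add], ?_⟩
      refine (Run.append hu hy).cast rfl rfl ?_ rfl
      rw [map_mul, factorLabel, Sum.elim_inr, map_one]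

/-- Completeness of the rules: a run is cut into one-edge blocks, and a block path of value one
shortens until it is a single trivial block or empty. Any family closed under the rules therefore
contains its edge multiset. -/
theorem mem_of_run (hlab : ∀ e, ∃ i, ∃ g : G i, CoprodI.of g = lab e)
    {σ : E ⊕ V × V → Set (Multiset (E ⊕ V × V))} (hl : ∀ e, σ (Sum.inl e) = {{Sum.inl e}})
    (hr : ∀ p, substitute σ (factorRules src tgt lab (Sum.inr p)) ⊆ σ (Sum.inr p))
    {p q : V} {x : Multiset E} (h : Run src tgt lab p q 1 x) :
    x.map Sum.inl ∈ σ (Sum.inr (p, q)) := by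
  -- A block is a run in one factor whose shortcuts have already been expanded by means of `σ`.
  let B : ∀ i : Bool, V → V → G i → Multiset (E ⊕ V × V) → Prop := fun i p q g z =>
    ∃ k, FactorRun src tgt lab i p q g k ∧ z ∈ ((k.map (Sum.map Subtype.val id)).map σ).sum
  have happ : ∀ {i p q r g h z w}, B i p q g z → B i q r h w → B i p r (g * h) (z + w) := by
    rintro i p q r g h z w ⟨k, hk, hz⟩ ⟨k', hk', hw⟩
    refine ⟨k + k', hk.append hk', ?_⟩
    rw [Multiset.map_add, Multiset.map_add, Multiset.sum_add]
    exact Set.add_mem_add hz hw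
  have hone : ∀ {i p q z}, B i p q 1 z → z ∈ σ (Sum.inr (p, q)) := by
    rintro i p q z ⟨k, hk, hz⟩
    exact hr _ (mem_substitute.2 ⟨_, Set.mem_iUnion.2 ⟨i, k, hk, rfl⟩, hz⟩)
  have hof : ∀ {i p q z}, z ∈ σ (Sum.inr (p, q)) → B i p q 1 z := by
    intro i p q z hz
    exact ⟨{Sum.inr (p, q)}, Run.single (src := Sum.elim (fun e => src e.1) Prod.fst)
      (tgt := Sum.elim (fun e => tgt e.1) Prod.snd) (lab := factorLabel lab i) (Sum.inr (p, q)),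
      by simpa using hz⟩
  have hpath : ∀ {p q g x}, Run src tgt lab p q g x →
      ∃ l, coprodValue l = g ∧ BlockPath B p q l (x.map Sum.inl) := by
    intro p q g x h
    induction h with
    | nil p => exact ⟨[], rfl, BlockPath.nil p⟩
    | cons e _ ih =>
      obtain ⟨l, rfl, hP⟩ := ih
      obtain ⟨i, hi⟩ := hlab e
      refine ⟨⟨i, hi.choose⟩ :: l, by rw [coprodValue_cons, hi.choose_spec], ?_⟩
      rw [Multiset.map_cons, ← Multiset.singleton_add]
      have hs : FactorRun src tgt lab i (src e) (tgt e) hi.choose {Sum.inl ⟨e, hi⟩} :=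
        Run.single (src := Sum.elim (fun e : FactorEdge lab i => src e.1) Prod.fst)
          (tgt := Sum.elim (fun e => tgt e.1) Prod.snd) (lab := factorLabel lab i) (Sum.inl ⟨e, hi⟩)
      exact BlockPath.cons ⟨_, hs, by simp [hl]⟩ hP
  obtain ⟨l, hl1, hP⟩ := hpath h
  exact hP.mem_of_coprodValue_eq_one (X := fun p q => σ (Sum.inr (p, q))) happ hone hof
    (fun p => hone (i := true) ⟨0, Run.nil p, by simp⟩) hl1

/-- The sets of value-one runs, one for each pair of vertices, form the least solution of
`factorRules`. Its right-hand sides are bounded by hypothesis, because they are Parikh images of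
value-one runs over a single factor. -/
theorem ParikhBounded.coprodI (hG : ∀ i, ParikhBounded (G i)) : ParikhBounded (CoprodI G) := by
  classical
  refine ParikhBounded.of_closure_eq_top CoprodI.mclosure_iUnion_range_of fun Y hY hYS => ?_
  -- The label `1` is added for the shortcut edges.
  have hfin : ∀ i, (insert 1 (CoprodI.of ⁻¹' Y) : Set (G i)).Finite := fun i =>
    (hY.preimage (CoprodI.of_injective i).injOn).insert 1
  choose F hF hFb using fun i => hG i _ (hfin i)
  let size : ℕ → ℕ := fun m => m + m * m
  have hsize : Primrec size :=
    Primrec.nat_add.comp Primrec.id (Primrec.nat_mul.comp Primrec.id Primrec.id)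
  let bound : ℕ → ℕ := fun m => size m + F true (size m) + F false (size m)
  have hbound : Primrec bound := Primrec.nat_add.comp
    (Primrec.nat_add.comp hsize ((hF true).comp hsize)) ((hF false).comp hsize)
  refine ⟨fun m => solutionBound (bound m), primrec_solutionBound.comp hbound,
    fun m V E _ _ src tgt lab hV hE hYe p q => ?_⟩
  have hlab : ∀ e, ∃ i, ∃ g : G i, CoprodI.of g = lab e := fun e => by
    rcases hYS (hYe e) with h | h
    · simpa using h
    · exact ⟨true, 1, by rw [map_one]; exact (Set.mem_singleton_iff.1 h).symm⟩
  have hVV : Nat.card (V × V) ≤ m * m := by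
    rw [Nat.card_prod]
    exact Nat.mul_le_mul hV hV
  have := Fintype.ofFinite (V × V)
  let U : Finset (E ⊕ V × V) := Finset.univ.map Function.Embedding.inr
  have hU : ∀ p, Sum.inr p ∈ (U : Set (E ⊕ V × V)) := fun p => by simp [U]
  have hUl : ∀ e, Sum.inl e ∉ (U : Set (E ⊕ V × V)) := fun e => by simp [U]
  have hFi : ∀ i, F i (size m) ≤ bound m := by
    rintro (_ | _) <;> simp only [bound] <;> omega
  have hK : ∀ i, BoundedSemilinear (bound m) (factorRules src tgt lab i) := by
    rintro (e | p)
    · intro x hx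
      exact hx.elim
    · refine BoundedSemilinear.iUnion fun i => (BoundedSemilinear.mono ?_ (hFi i)).image _ (by simp)
      refine hFb i (size m) V (FactorEdge lab i ⊕ V × V) _ _ _ (by simp only [size]; omega) ?_ ?_ _ _
      · rw [Nat.card_sum]
        exact add_le_add ((Nat.card_le_card_of_injective _ Subtype.val_injective).trans hE) hVV
      · rintro (e | e)
        · refine Or.inr ?_
          rw [Set.mem_preimage, factorLabel, Sum.elim_inl, e.2.choose_spec]
          exact hYe e.1
        · exact Or.inl rfl
  have hIcard : Nat.card (E ⊕ V × V) ≤ bound m := by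
    rw [Nat.card_sum]
    simp only [bound, size]
    omega
  obtain ⟨X, hX, hclosed, hleast⟩ := exists_least_solution U hIcard _ hK
  have hUcard : U.card ≤ bound m := by
    rw [Finset.card_map, Finset.card_univ, ← Nat.card_eq_fintype_card]
    simp only [bound, size]
    omega
  have hXpq := (((hX _ (hU (p, q))).mono (iterate_le_solutionBound hUcard)).image Multiset.lefts
    Multiset.card_lefts_le)
  convert hXpq using 1
  ext x
  constructor
  · intro hx
    refine ⟨x.map Sum.inl, ?_, by simp⟩
    have := mem_of_run hlab (σ := substOn U X) (fun e => substOn_of_notMem (hUl e) X)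
      (fun p => by
        rw [substOn_of_mem (hU p)]
        exact hclosed _ (hU p)) hx
    rwa [substOn_of_mem (hU _)] at this
  · rintro ⟨y, hy, rfl⟩
    -- The actual sets of value-one runs satisfy the system, so the least solution lies below them.
    let R : E ⊕ V × V → Set (Multiset (E ⊕ V × V)) := Sum.elim (fun _ => ∅) fun p =>
      Multiset.map Sum.inl '' {x | Run src tgt lab p.1 p.2 1 x}
    obtain ⟨x, hx, rfl⟩ : y ∈ R (Sum.inr (p, q)) := by
      refine hleast R ?_ _ (hU _) hy
      rintro (e | p) hi
      · exact absurd hi (hUl e)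
      · intro x hx
        obtain ⟨k', hk', hx⟩ := mem_substitute.1 hx
        obtain ⟨i, k, hk, rfl⟩ := Set.mem_iUnion.1 hk'
        obtain ⟨y, rfl, hy⟩ := run_of_factorRun hk (fun e => substOn_of_notMem (hUl e) R)
          (fun p => substOn_of_mem (hU p) R) x hx
        exact ⟨y, hy.cast rfl rfl (map_one _) rfl, rfl⟩
    simpa using hx

end FreeProduct

/-! ### The word problem -/

/-- The word problem, with respect to every finite family of elements, is primitive recursive. -/
def PrimrecWordProblem (G : Type*) [Monoid G] : Prop :=
  ∀ (α : Type) [Primcodable α] [Finite α] (φ : α → G),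
    PrimrecPred fun w : List α => (w.map φ).prod = 1

namespace PrimrecWordProblem

theorem of_injective {G H : Type*} [Monoid G] [Monoid H] (hH : PrimrecWordProblem H)
    (f : G →* H) (hf : Function.Injective f) : PrimrecWordProblem G := by
  intro α _ _ φ
  refine (hH α (f ∘ φ)).of_eq fun w => ?_
  rw [← List.map_map, ← map_list_prod, map_eq_one_iff f hf]

theorem of_subsingleton {G : Type*} [Monoid G] [Subsingleton G] : PrimrecWordProblem G := by
  intro α _ _ φ
  exact (Primrec.primrecPred (p := fun _ => True) (by simpa using Primrec.const true)).of_eq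
    fun w => by simp [Subsingleton.elim (w.map φ).prod 1]

section Semidirect

variable {N A : Type*} [Group N] [Group A] (ψ : A →* MulAut N) (π : Multiplicative ℤ →* A)
  {α : Type*} (φ : α → N ⋊[ψ.comp π] Multiplicative ℤ)

/-- Every letter of a word, with the element of `A` that acts on it. -/
def twist (w : List α) : List (α × A) :=
  w.foldr (fun a l => (a, 1) :: l.map fun b => (b.1, π (φ a).right * b.2)) []

/-- In `twist`, a letter carries the product of the `A`-images of the letters before it, which is
the element acting on its `N`-component in the semidirect product. The parameter `c` makes the
induction work. -/
theorem prod_twist (w : List α) (c : A) :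
    ((twist ψ π φ w).map fun b => ψ (c * b.2) (φ b.1).left).prod = ψ c (w.map φ).prod.left := by
  induction w generalizing c with
  | nil => simp [twist]
  | cons a w ih =>
    have := ih (c * π (φ a).right)
    simp only [twist, List.foldr_cons, List.map_cons, List.map_map, List.prod_cons,
      SemidirectProduct.mul_left, map_mul, MonoidHom.comp_apply] at this ⊢
    congr 1
    · simp
    · rw [← MulAut.mul_apply, ← this]
      simp only [Function.comp_def, map_mul, mul_assoc]

/-- Positive and negative parts are summed separately, so that triviality becomes an equality of two
natural numbers. -/
theorem right_prod (w : List α) :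
    (w.map φ).prod.right.toAdd =
      (w.foldr (fun a n => (φ a).right.toAdd.toNat + n) 0 : ℕ) -
      (w.foldr (fun a n => (-(φ a).right.toAdd).toNat + n) 0 : ℕ) := by
  induction w with
  | nil => simp
  | cons a w ih =>
    rw [List.map_cons, List.prod_cons, SemidirectProduct.mul_right, toAdd_mul, ih]
    simp only [List.foldr_cons]
    push_cast
    have := Int.toNat_sub_toNat_neg (φ a).right.toAdd
    omega

end Semidirect

/-- The `N`-component is tested on a word over the finite alphabet `α × A`, the `ℤ`-component by
comparing two sums. -/
theorem semidirectProduct {N : Type*} {A : Type} [Group N] [Group A] [Finite A]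
    [Primcodable A] (ψ : A →* MulAut N) (π : Multiplicative ℤ →* A) (hN : PrimrecWordProblem N) :
    PrimrecWordProblem (N ⋊[ψ.comp π] Multiplicative ℤ) := by
  intro α _ _ φ
  have htwist : Primrec (twist ψ π φ) := by
    have hact : Primrec₂ fun (a : α) (b : α × A) => (b.1, π (φ a).right * b.2) :=
      (Primrec.dom_finite fun x : α × (α × A) => (x.2.1, π (φ x.1).right * x.2.2))
    have hmap : Primrec fun x : List α × α × List (α × A) =>
        x.2.2.map fun b => (b.1, π (φ x.2.1).right * b.2) :=
      Primrec.list_map (Primrec.snd.comp Primrec.snd)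
        (hact.comp (Primrec.fst.comp (Primrec.snd.comp Primrec.fst)) Primrec.snd)
    have hstep : Primrec₂ fun (_ : List α) (x : α × List (α × A)) =>
        (x.1, (1 : A)) :: x.2.map fun b => (b.1, π (φ x.1).right * b.2) :=
      Primrec.list_cons.comp
        (Primrec.pair (Primrec.fst.comp Primrec.snd) (Primrec.const 1)) hmap
    exact Primrec.list_foldr Primrec.id (Primrec.const []) hstep
  have hsum : ∀ f : α → ℕ, Primrec fun w : List α => w.foldr (fun a n => f a + n) 0 := fun f => by
    have hstep : Primrec₂ fun (_ : List α) (x : α × ℕ) => f x.1 + x.2 :=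
      Primrec.nat_add.comp ((Primrec.dom_finite f).comp (Primrec.fst.comp Primrec.snd))
        (Primrec.snd.comp Primrec.snd)
    exact Primrec.list_foldr Primrec.id (Primrec.const 0) hstep
  refine (((hN (α × A) fun b => ψ b.2 (φ b.1).left).comp htwist).and
    (Primrec.eq.comp (hsum fun a => (φ a).right.toAdd.toNat)
      (hsum fun a => (-(φ a).right.toAdd).toNat))).of_eq fun w => ?_
  have h1 := prod_twist ψ π φ w 1
  have h2 := right_prod ψ π φ w
  simp only [one_mul, map_one, MulAut.one_apply] at h1
  rw [h1, SemidirectProduct.ext_iff, SemidirectProduct.one_left, SemidirectProduct.one_right]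
  refine and_congr Iff.rfl ⟨fun h => ?_, fun h => ?_⟩
  · rw [h, sub_self] at h2
    exact congrArg Multiplicative.ofAdd h2
  · rw [h, toAdd_one] at h2
    omega

section FreeProduct

variable {G : Bool → Type*} [∀ i, Group (G i)] {β : Type*} (L : β → Σ i, G i)

/-- The component of a letter in the factor `i`, which is trivial for the letters of the other
factor. -/
def component (i : Bool) (b : β) : G i :=
  if h : (L b).1 = i then h ▸ (L b).2 else 1

/-- The value of a block of letters in the factor `B.1`. -/
def blockValue (B : Bool × List β) : Σ i, G i := ⟨B.1, (B.2.map (component L B.1)).prod⟩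

theorem component_self (b : β) : component L (L b).1 b = (L b).2 := by simp [component]

open Classical in
/-- Put a block on a stack of blocks, unless it is trivial. -/
noncomputable def pushBlock (B : Bool × List β) (l : List (Bool × List β)) :
    List (Bool × List β) :=
  if (blockValue L B).2 = 1 then l else B :: l

/-- Multiply the element represented by a stack of blocks by a letter from the left. -/
noncomputable def pushLetter (b : β) (l : List (Bool × List β)) : List (Bool × List β) :=
  match l with
  | [] => pushBlock L ((L b).1, [b]) []
  | B :: l => if B.1 = (L b).1 then pushBlock L ((L b).1, b :: B.2) l
      else pushBlock L ((L b).1, [b]) (B :: l)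

/-- The normal form of a word in a free product. -/
noncomputable def normalForm (w : List β) : List (Bool × List β) := w.foldr (pushLetter L) []

theorem coprodValue_pushBlock (B : Bool × List β) (l : List (Bool × List β)) :
    coprodValue ((pushBlock L B l).map (blockValue L)) =
      CoprodI.of (blockValue L B).2 * coprodValue (l.map (blockValue L)) := by
  unfold pushBlock
  split_ifs with h
  · rw [h, map_one, one_mul]
  · rw [List.map_cons, coprodValue_cons]

theorem isReducedList_pushBlock {B : Bool × List β} {l : List (Bool × List β)}
    (hl : IsReducedList (l.map (blockValue L))) (hB : ∀ C ∈ l.head?, B.1 ≠ C.1) :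
    IsReducedList ((pushBlock L B l).map (blockValue L)) := by
  unfold pushBlock
  split_ifs with h
  · exact hl
  · refine ⟨?_, ?_⟩
    · intro s hs
      rcases List.mem_cons.1 hs with rfl | hs
      exacts [h, hl.1 s hs]
    · rw [List.map_cons, List.isChain_cons]
      refine ⟨?_, hl.2⟩
      intro s hs
      rw [List.head?_map] at hs
      obtain ⟨C, hC, rfl⟩ := Option.mem_map.1 hs
      exact hB C hC

/-- A letter either joins the top block, if the factors agree, or forms a new one. If that block is
trivial it is dropped, and what lies below is still reduced. -/
theorem pushLetter_spec (b : β) (l : List (Bool × List β))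
    (hl : IsReducedList (l.map (blockValue L))) :
    IsReducedList ((pushLetter L b l).map (blockValue L)) ∧
      coprodValue ((pushLetter L b l).map (blockValue L)) =
        CoprodI.of (L b).2 * coprodValue (l.map (blockValue L)) := by
  have hb : CoprodI.of (blockValue L ((L b).1, [b])).2 = CoprodI.of (L b).2 := by
    simp only [blockValue, List.map_cons, List.map_nil, List.prod_cons, List.prod_nil, mul_one,
      component_self]
    rfl
  rcases l with _ | ⟨B, l⟩
  · refine ⟨isReducedList_pushBlock L hl (by simp), ?_⟩
    rw [pushLetter, coprodValue_pushBlock, hb]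
  · by_cases h : B.1 = (L b).1
    · have hl' : IsReducedList (l.map (blockValue L)) :=
        ⟨fun s hs => hl.1 s (List.mem_cons_of_mem _ hs), (List.isChain_cons.1 hl.2).2⟩
      obtain ⟨i, x⟩ := B
      simp only at h
      subst h
      simp only [pushLetter, if_true]
      refine ⟨isReducedList_pushBlock L hl' ?_, ?_⟩
      · intro C hC
        refine (List.isChain_cons.1 hl.2).1 (blockValue L C) ?_
        rw [List.head?_map]
        exact Option.mem_map_of_mem _ hC
      · rw [coprodValue_pushBlock, List.map_cons, coprodValue_cons, ← mul_assoc]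
        congr 1
        simp only [blockValue, List.map_cons, List.prod_cons, component_self]
        exact map_mul CoprodI.of _ _
    · simp only [pushLetter, if_neg h]
      refine ⟨isReducedList_pushBlock L hl ?_, ?_⟩
      · intro C hC
        obtain rfl : B = C := by simpa using hC
        exact Ne.symm h
      · rw [coprodValue_pushBlock, hb]

theorem normalForm_spec (w : List β) :
    IsReducedList ((normalForm L w).map (blockValue L)) ∧
      coprodValue ((normalForm L w).map (blockValue L)) = coprodValue (w.map L) := by
  induction w with
  | nil => exact ⟨⟨by simp [normalForm], by simp [normalForm]⟩, rfl⟩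
  | cons b w ih =>
    obtain ⟨h1, h2⟩ := pushLetter_spec L b (normalForm L w) ih.1
    exact ⟨h1, h2.trans (by rw [ih.2, List.map_cons, coprodValue_cons])⟩

theorem coprodValue_eq_one_iff (w : List β) :
    coprodValue (w.map L) = 1 ↔ normalForm L w = [] := by
  obtain ⟨h1, h2⟩ := normalForm_spec L w
  constructor
  · intro h
    exact List.map_eq_nil_iff.1 (h1.eq_nil (h2.trans h))
  · intro h
    rw [← h2, h]
    rfl

/-- Blocks are stored as words rather than group elements; the only test on their values is
triviality, which is the word problem in a factor. -/
theorem primrec_normalForm {β : Type} [Primcodable β] [Finite β] (L : β → Σ i, G i)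
    (hG : ∀ i, PrimrecWordProblem (G i)) : Primrec (normalForm L) := by
  classical
  have htriv : PrimrecPred fun B : Bool × List β => (blockValue L B).2 = 1 := by
    have h : ∀ i, PrimrecPred fun B : Bool × List β =>
        B.1 = i ∧ (B.2.map (component L i)).prod = 1 := fun i =>
      (Primrec.eq.comp Primrec.fst (Primrec.const i)).and ((hG i β (component L i)).comp Primrec.snd)
    refine ((h true).or (h false)).of_eq ?_
    rintro ⟨_ | _, l⟩ <;> simp [blockValue] <;> rfl
  have hpush : Primrec₂ (pushBlock L) :=
    Primrec.ite (htriv.comp Primrec.fst) Primrec.snd Primrec.list_cons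
  have hcol : Primrec fun b : β => (L b).1 := Primrec.dom_finite _
  have hletter : Primrec₂ (pushLetter L) := by
    have hcol' : Primrec fun x : (β × List (Bool × List β)) × (Bool × List β) × List (Bool × List β)
        => (L x.1.1).1 := hcol.comp (Primrec.fst.comp Primrec.fst)
    have hB : Primrec fun x : (β × List (Bool × List β)) × (Bool × List β) × List (Bool × List β)
        => x.2.1 := Primrec.fst.comp Primrec.snd
    have hb : Primrec fun x : (β × List (Bool × List β)) × (Bool × List β) × List (Bool × List β)
        => x.1.1 := Primrec.fst.comp Primrec.fst
    have hnil : Primrec fun x : β × List (Bool × List β) =>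
        pushBlock L ((L x.1).1, [x.1]) ([] : List (Bool × List β)) :=
      hpush.comp (Primrec.pair (hcol.comp Primrec.fst)
        (Primrec.list_cons.comp Primrec.fst (Primrec.const []))) (Primrec.const [])
    have hcons : Primrec₂ fun (x : β × List (Bool × List β))
        (y : (Bool × List β) × List (Bool × List β)) =>
        if y.1.1 = (L x.1).1 then pushBlock L ((L x.1).1, x.1 :: y.1.2) y.2
        else pushBlock L ((L x.1).1, [x.1]) (y.1 :: y.2) :=
      Primrec.ite (Primrec.eq.comp (Primrec.fst.comp hB) hcol')
        (hpush.comp (Primrec.pair hcol' (Primrec.list_cons.comp hb (Primrec.snd.comp hB)))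
          (Primrec.snd.comp Primrec.snd))
        (hpush.comp (Primrec.pair hcol' (Primrec.list_cons.comp hb (Primrec.const [])))
          (Primrec.list_cons.comp hB (Primrec.snd.comp Primrec.snd)))
    refine (Primrec.list_casesOn Primrec.snd hnil hcons).of_eq ?_
    rintro ⟨b, _ | ⟨B, l⟩⟩ <;> rfl
  have hstep : Primrec₂ fun (_ : List β) (x : β × List (Bool × List β)) => pushLetter L x.1 x.2 :=
    hletter.comp (Primrec.fst.comp Primrec.snd) (Primrec.snd.comp Primrec.snd)
  exact Primrec.list_foldr Primrec.id (Primrec.const []) hstep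

end FreeProduct

theorem exists_coprodValue_eq {G : Bool → Type*} [∀ i, Group (G i)] (x : CoprodI G) :
    ∃ l : List (Σ i, G i), coprodValue l = x := by
  induction x using CoprodI.induction_left with
  | one => exact ⟨[], rfl⟩
  | mul m x ih =>
    obtain ⟨l, rfl⟩ := ih
    exact ⟨⟨_, m⟩ :: l, by simp⟩

/-- Each of the finitely many generators is spelled by elements of the factors. Only finitely many
of these occur, so rewriting the word letter by letter reduces to `normalForm`. -/
theorem coprodI {G : Bool → Type*} [∀ i, Group (G i)] (hG : ∀ i, PrimrecWordProblem (G i)) :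
    PrimrecWordProblem (CoprodI G) := by
  intro α _ _ φ
  choose r hr using fun a => exists_coprodValue_eq (φ a)
  have hfin : (⋃ a, {s | s ∈ r a}).Finite := Set.finite_iUnion fun a => (r a).finite_toSet
  obtain ⟨n, L, hL⟩ := hfin.fin_param
  have hlift : ∀ a, ∃ l : List (Fin n), l.map L = r a := fun a => by
    have : r a ∈ Set.range (List.map L) := by
      rw [Set.range_list_map, hL.2]
      exact fun s hs => Set.mem_iUnion.2 ⟨a, hs⟩
    exact this
  choose f hf using hlift
  have hword : ∀ w : List α, coprodValue ((w.flatMap f).map L) = (w.map φ).prod := by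
    intro w
    induction w with
    | nil => rfl
    | cons a w ih =>
      have happ : ∀ l m : List (Σ i, G i), coprodValue (l ++ m) = coprodValue l * coprodValue m := by
        simp [coprodValue]
      rw [List.flatMap_cons, List.map_append, happ, ih, hf, hr, List.map_cons, List.prod_cons]
  have hf₂ : Primrec₂ fun (_ : List α) a => f a := (Primrec.dom_finite f).comp Primrec.snd
  refine (Primrec.eq.comp ((primrec_normalForm L hG).comp
    (Primrec.list_flatMap Primrec.id hf₂)) (Primrec.const [])).of_eq fun w => ?_
  rw [← hword, coprodValue_eq_one_iff]
  rfl

end PrimrecWordProblem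

/-! ### Twisted Artin groups of disjoint unions and cones -/

namespace MixedGraph

namespace TwistedRAAG

variable {V : Type*} (Γ : MixedGraph V)

/-- The generators of `T(Γ)`. -/
def of (v : V) : Γ.TwistedRAAG := PresentedGroup.of v

variable {Γ}

theorem of_mul_of_undir {a b : V} (h : Γ.Undir a b) : of Γ a * of Γ b = of Γ b * of Γ a := by
  have : (PresentedGroup.mk Γ.relators) (FreeGroup.of a * FreeGroup.of b * (FreeGroup.of a)⁻¹ *
      (FreeGroup.of b)⁻¹) = 1 := PresentedGroup.one_of_mem (Or.inl ⟨a, b, h, rfl⟩)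
  simp only [map_mul, map_inv] at this
  rw [mul_inv_eq_one, mul_inv_eq_iff_eq_mul] at this
  exact this

theorem of_mul_of_dir {a b : V} (h : Γ.Dir a b) : of Γ a * of Γ b * of Γ a = of Γ b := by
  have : (PresentedGroup.mk Γ.relators) (FreeGroup.of a * FreeGroup.of b * FreeGroup.of a *
      (FreeGroup.of b)⁻¹) = 1 := PresentedGroup.one_of_mem (Or.inr ⟨a, b, h, rfl⟩)
  simp only [map_mul, map_inv] at this
  rwa [mul_inv_eq_one] at this

/-- The universal property of `T(Γ)`. -/
def lift {G : Type*} [Group G] (f : V → G) (hu : ∀ a b, Γ.Undir a b → f a * f b = f b * f a)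
    (hd : ∀ a b, Γ.Dir a b → f a * f b * f a = f b) : Γ.TwistedRAAG →* G :=
  PresentedGroup.toGroup (f := f) (by
    rintro r (⟨a, b, h, rfl⟩ | ⟨a, b, h, rfl⟩)
    · simp [hu a b h]
    · simp [hd a b h])

@[simp] theorem lift_of {G : Type*} [Group G] (f : V → G)
    (hu : ∀ a b, Γ.Undir a b → f a * f b = f b * f a)
    (hd : ∀ a b, Γ.Dir a b → f a * f b * f a = f b) (v : V) : lift f hu hd (of Γ v) = f v :=
  PresentedGroup.toGroup.of _

theorem hom_ext {G : Type*} [Group G] {f g : Γ.TwistedRAAG →* G}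
    (h : ∀ v, f (of Γ v) = g (of Γ v)) : f = g := PresentedGroup.ext h

theorem subsingleton_of_isEmpty [IsEmpty V] : Subsingleton Γ.TwistedRAAG := by
  have h : MonoidHom.id Γ.TwistedRAAG = 1 := hom_ext fun v => isEmptyElim v
  exact ⟨fun x y => (DFunLike.congr_fun h x).trans (DFunLike.congr_fun h y).symm⟩

theorem injective_of_leftInverse {G : Type*} [Group G] {f : Γ.TwistedRAAG →* G}
    {g : G →* Γ.TwistedRAAG} (h : ∀ v, g (f (of Γ v)) = of Γ v) : Function.Injective f := by
  have : g.comp f = MonoidHom.id _ := hom_ext h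
  exact Function.LeftInverse.injective (DFunLike.congr_fun this)

/-- Functoriality of `T` for maps that preserve both types of edges. -/
def map {W : Type*} {Δ : MixedGraph W} (e : V → W) (hu : ∀ a b, Γ.Undir a b → Δ.Undir (e a) (e b))
    (hd : ∀ a b, Γ.Dir a b → Δ.Dir (e a) (e b)) : Γ.TwistedRAAG →* Δ.TwistedRAAG :=
  lift (fun v => of Δ (e v)) (fun a b h => of_mul_of_undir (hu a b h))
    fun a b h => of_mul_of_dir (hd a b h)

@[simp] theorem map_of {W : Type*} {Δ : MixedGraph W} (e : V → W)
    (hu : ∀ a b, Γ.Undir a b → Δ.Undir (e a) (e b)) (hd : ∀ a b, Γ.Dir a b → Δ.Dir (e a) (e b))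
    (v : V) : map e hu hd (of Γ v) = of Δ (e v) := lift_of _ _ _ v

/-- An embedding is enough here and in the cases below, because the properties in question pass to
subgroups. -/
theorem exists_injective_of_equiv {W : Type*} {Δ : MixedGraph W} (e : V ≃ W)
    (adj_iff : ∀ a b, Δ.graph.Adj (e a) (e b) ↔ Γ.graph.Adj a b)
    (dir_iff : ∀ a b, Δ.Dir (e a) (e b) ↔ Γ.Dir a b) :
    ∃ f : Δ.TwistedRAAG →* Γ.TwistedRAAG, Function.Injective f := by
  have hu : ∀ a b, Γ.Undir a b → Δ.Undir (e a) (e b) := fun a b h => by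
    unfold Undir
    rw [adj_iff, dir_iff, dir_iff]
    exact h
  have hd' : ∀ a b, Δ.Dir a b → Γ.Dir (e.symm a) (e.symm b) := fun a b h => by
    rw [← dir_iff]
    simpa using h
  have hu' : ∀ a b, Δ.Undir a b → Γ.Undir (e.symm a) (e.symm b) := fun a b h => by
    unfold Undir
    rw [← adj_iff, ← dir_iff, ← dir_iff, e.apply_symm_apply, e.apply_symm_apply]
    exact h
  exact ⟨map e.symm hu' hd', injective_of_leftInverse
    (g := map e hu fun a b h => (dir_iff a b).2 h) fun v => by simp⟩

section DisjointUnion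

variable {V W : Type u} (Γ : MixedGraph V) (Δ : MixedGraph W)

/-- The two free factors of `T(Γ ⊔ Δ)`. -/
abbrev Factor : Bool → Type u
  | true => Γ.TwistedRAAG
  | false => Δ.TwistedRAAG

instance : ∀ i, Group (Factor Γ Δ i)
  | true => inferInstanceAs (Group Γ.TwistedRAAG)
  | false => inferInstanceAs (Group Δ.TwistedRAAG)

theorem exists_injective_coprodI :
    ∃ f : (Γ.disjointUnion Δ).TwistedRAAG →* CoprodI (Factor Γ Δ), Function.Injective f := by
  let ι₁ : Γ.TwistedRAAG →* CoprodI (Factor Γ Δ) := CoprodI.of (M := Factor Γ Δ) (i := true)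
  let ι₂ : Δ.TwistedRAAG →* CoprodI (Factor Γ Δ) := CoprodI.of (M := Factor Γ Δ) (i := false)
  let f : (Γ.disjointUnion Δ).TwistedRAAG →* CoprodI (Factor Γ Δ) :=
    lift (Sum.elim (fun v => ι₁ (of Γ v)) fun w => ι₂ (of Δ w))
      (by
        rintro (a | a) (b | b) ⟨h, h1, h2⟩
        · simp only [Sum.elim_inl, ← map_mul]
          rw [of_mul_of_undir (Γ := Γ) ⟨by simpa [disjointUnion] using h, h1, h2⟩]
        · simp [disjointUnion] at h
        · simp [disjointUnion] at h
        · simp only [Sum.elim_inr, ← map_mul]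
          rw [of_mul_of_undir (Γ := Δ) ⟨by simpa [disjointUnion] using h, h1, h2⟩])
      (by
        rintro (a | a) (b | b) h
        · simp only [Sum.elim_inl, ← map_mul]
          rw [of_mul_of_dir (show Γ.Dir a b from h)]
        · exact h.elim
        · exact h.elim
        · simp only [Sum.elim_inr, ← map_mul]
          rw [of_mul_of_dir (show Δ.Dir a b from h)])
  let g₁ : Γ.TwistedRAAG →* (Γ.disjointUnion Δ).TwistedRAAG := map Sum.inl
    (fun a b h => ⟨by simpa [disjointUnion] using h.1, h.2.1, h.2.2⟩) fun a b h => h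
  let g₂ : Δ.TwistedRAAG →* (Γ.disjointUnion Δ).TwistedRAAG := map Sum.inr
    (fun a b h => ⟨by simpa [disjointUnion] using h.1, h.2.1, h.2.2⟩) fun a b h => h
  let k : ∀ i, Factor Γ Δ i →* (Γ.disjointUnion Δ).TwistedRAAG := fun | true => g₁ | false => g₂
  let g : CoprodI (Factor Γ Δ) →* (Γ.disjointUnion Δ).TwistedRAAG := CoprodI.lift k
  refine ⟨f, injective_of_leftInverse (g := g) ?_⟩
  have h₁ : ∀ x, g (ι₁ x) = g₁ x := fun x => CoprodI.lift_of k (i := true) x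
  have h₂ : ∀ x, g (ι₂ x) = g₂ x := fun x => CoprodI.lift_of k (i := false) x
  have hg₁ : ∀ v, g₁ (of Γ v) = of _ (Sum.inl v) := map_of _ _ _
  have hg₂ : ∀ w, g₂ (of Δ w) = of _ (Sum.inr w) := map_of _ _ _
  rintro (v | w)
  · simp [f, h₁, hg₁]
  · simp [f, h₂, hg₂]

end DisjointUnion

section Cone

variable {V : Type*} (Γ : MixedGraph V) (S : Set V)

open Classical in
/-- The action of a sign on `T(Γ)`: it inverts the generators in `S` if the sign is negative. -/
noncomputable def signHom (s : ℤˣ) : Γ.TwistedRAAG →* Γ.TwistedRAAG :=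
  lift (fun v => if v ∈ S then of Γ v ^ (s : ℤ) else of Γ v)
    (fun a b h => by
      have : Commute (of Γ a) (of Γ b) := of_mul_of_undir h
      split_ifs
      · exact (this.zpow_zpow _ _).eq
      · exact (this.zpow_left _).eq
      · exact (this.zpow_right _).eq
      · exact this.eq)
    (fun a b h => by
      have h := of_mul_of_dir h
      -- The Klein relation survives inverting either generator or both; these are the cases that
      -- arise when `a` or `b` lies in `S`.
      have h' : (of Γ a)⁻¹ * of Γ b * (of Γ a)⁻¹ = of Γ b := by
        nth_rewrite 1 [← h]
        group
      have hi : of Γ a * (of Γ b)⁻¹ * of Γ a = (of Γ b)⁻¹ := by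
        nth_rewrite 2 [← h']
        group
      have hi' : (of Γ a)⁻¹ * (of Γ b)⁻¹ * (of Γ a)⁻¹ = (of Γ b)⁻¹ := by
        nth_rewrite 2 [← h]
        group
      rcases Int.units_eq_one_or s with rfl | rfl <;> split_ifs <;> simpa)

theorem signHom_of_mem {v : V} (hv : v ∈ S) (s : ℤˣ) :
    signHom Γ S s (of Γ v) = of Γ v ^ (s : ℤ) := by
  simp [signHom, hv]

theorem signHom_of_notMem {v : V} (hv : v ∉ S) (s : ℤˣ) :
    signHom Γ S s (of Γ v) = of Γ v := by
  simp [signHom, hv]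

theorem signHom_one : signHom Γ S 1 = MonoidHom.id _ := hom_ext fun v => by
  by_cases hv : v ∈ S
  · simp [signHom_of_mem Γ S hv]
  · simp [signHom_of_notMem Γ S hv]

theorem signHom_mul (s t : ℤˣ) : signHom Γ S (s * t) = (signHom Γ S s).comp (signHom Γ S t) :=
  hom_ext fun v => by
    by_cases hv : v ∈ S
    · simp [signHom_of_mem Γ S hv, zpow_mul]
    · simp [signHom_of_notMem Γ S hv]

/-- The action of the group of signs on `T(Γ)`. -/
noncomputable def signAction : ℤˣ →* MulAut Γ.TwistedRAAG where
  toFun s := MonoidHom.toMulEquiv (signHom Γ S s) (signHom Γ S s)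
    (by rw [← signHom_mul, Int.units_mul_self, signHom_one])
    (by rw [← signHom_mul, Int.units_mul_self, signHom_one])
  map_one' := by
    ext x
    exact DFunLike.congr_fun (signHom_one Γ S) x
  map_mul' s t := by
    ext x
    exact DFunLike.congr_fun (signHom_mul Γ S s t) x

theorem signAction_apply (s : ℤˣ) (x : Γ.TwistedRAAG) : signAction Γ S s x = signHom Γ S s x := rfl

/-- The sign of an integer modulo two. -/
noncomputable def parityHom : Multiplicative ℤ →* ℤˣ := zpowersHom ℤˣ (-1)

theorem parityHom_one : parityHom (Multiplicative.ofAdd 1) = -1 := by simp [parityHom]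

/-- The elements `g` for which the identity holds form a subgroup, and it contains the generator of
`ℤ`. -/
theorem map_zpow_action {N H : Type*} [Group N] [Group H] (φ : Multiplicative ℤ →* MulAut N)
    (f : N →* H) (h : H) (hf : ∀ n, f (φ (Multiplicative.ofAdd 1) n) = h * f n * h⁻¹)
    (g : Multiplicative ℤ) (n : N) :
    f (φ g n) = zpowersHom H h g * f n * (zpowersHom H h g)⁻¹ := by
  let K : Subgroup (Multiplicative ℤ) :=
    { carrier := {g | ∀ n, f (φ g n) = zpowersHom H h g * f n * (zpowersHom H h g)⁻¹}
      one_mem' := by simp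
      mul_mem' := by
        intro a b ha hb n
        rw [map_mul, MulAut.mul_apply, ha, hb, map_mul]
        group
      inv_mem' := by
        intro a ha n
        have := ha (φ a⁻¹ n)
        rw [← MulAut.mul_apply, ← map_mul, mul_inv_cancel, map_one, MulAut.one_apply] at this
        rw [this, map_inv (zpowersHom H h)]
        generalize f (φ a⁻¹ n) = z
        group }
  have h1 : Multiplicative.ofAdd (1 : ℤ) ∈ K := fun n => by simpa using hf n
  have h2 : g ∈ K := by
    have : g = Multiplicative.ofAdd (1 : ℤ) ^ g.toAdd := by
      rw [← ofAdd_zsmul]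
      simp
    rw [this]
    exact K.zpow_mem h1 _
  exact h2 n

/-- The relations at the tip say that conjugation by it is `signHom Γ S (-1)`. So the tip can be
sent to the generator of `ℤ`, and the universal property of the semidirect product supplies a left
inverse. -/
theorem exists_injective_semidirectProduct :
    ∃ f : (Γ.cone S).TwistedRAAG →*
      Γ.TwistedRAAG ⋊[(signAction Γ S).comp parityHom] Multiplicative ℤ,
      Function.Injective f := by
  set φ := (signAction Γ S).comp parityHom with hφ
  let t : Γ.TwistedRAAG ⋊[φ] Multiplicative ℤ := SemidirectProduct.inr (Multiplicative.ofAdd 1)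
  let i : Γ.TwistedRAAG →* Γ.TwistedRAAG ⋊[φ] Multiplicative ℤ := SemidirectProduct.inl
  have hφ1 : ∀ x, φ (Multiplicative.ofAdd 1) x = signHom Γ S (-1) x := fun x => by
    rw [hφ, MonoidHom.comp_apply, parityHom_one, signAction_apply]
  have ht : ∀ x, t * i x = i (signHom Γ S (-1) x) * t := fun x => by
    rw [← hφ1]
    simp only [t, i, SemidirectProduct.inl_aut, map_inv, inv_mul_cancel_right]
  have hcomm : ∀ v, v ∉ S → t * i (of Γ v) = i (of Γ v) * t := fun v hv => by
    rw [ht, signHom_of_notMem Γ S hv]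
  have hinv : ∀ v, v ∈ S → i (of Γ v) * t * i (of Γ v) = t := fun v hv => by
    rw [mul_assoc, ht, signHom_of_mem Γ S hv]
    simp
  let f : (Γ.cone S).TwistedRAAG →* Γ.TwistedRAAG ⋊[φ] Multiplicative ℤ :=
    lift (fun o => o.elim t fun v => i (of Γ v))
      (by
        rintro (_ | a) (_ | b) ⟨h, h1, h2⟩
        · exact h.elim
        · exact hcomm b h2
        · exact (hcomm a h1).symm
        · simp only [Option.elim_some, ← map_mul]
          rw [of_mul_of_undir (Γ := Γ) ⟨h, h1, h2⟩])
      (by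
        rintro (_ | a) (_ | b) h
        · exact h.elim
        · exact h.elim
        · exact hinv a h
        · simp only [Option.elim_some, ← map_mul]
          rw [of_mul_of_dir (show Γ.Dir a b from h)])
  let g₁ : Γ.TwistedRAAG →* (Γ.cone S).TwistedRAAG :=
    map some (fun a b h => ⟨h.1, h.2.1, h.2.2⟩) fun a b h => h
  have hg₁of : ∀ v, g₁ (of Γ v) = of (Γ.cone S) (some v) := map_of _ _ _
  have hg₁ : ∀ n, g₁ (φ (Multiplicative.ofAdd 1) n) =
      of (Γ.cone S) none * g₁ n * (of (Γ.cone S) none)⁻¹ := by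
    have : g₁.comp (signHom Γ S (-1)) =
        (MulAut.conj (of (Γ.cone S) none)).toMonoidHom.comp g₁ := hom_ext fun v => by
      by_cases hv : v ∈ S
      · have h := of_mul_of_dir (Γ := Γ.cone S) (a := some v) (b := none) hv
        simp only [MonoidHom.comp_apply, signHom_of_mem Γ S hv, map_inv, hg₁of,
          MulEquiv.coe_toMonoidHom, MulAut.conj_apply, Units.val_neg, Units.val_one, zpow_neg,
          zpow_one]
        rw [eq_mul_inv_iff_mul_eq, inv_mul_eq_iff_eq_mul, ← mul_assoc, h]
      · have h := of_mul_of_undir (Γ := Γ.cone S) (a := some v) (b := none) ⟨trivial, hv, id⟩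
        simp only [MonoidHom.comp_apply, signHom_of_notMem Γ S hv, hg₁of,
          MulEquiv.coe_toMonoidHom, MulAut.conj_apply]
        rw [← h]
        group
    intro n
    rw [hφ1]
    exact DFunLike.congr_fun this n
  let g : Γ.TwistedRAAG ⋊[φ] Multiplicative ℤ →* (Γ.cone S).TwistedRAAG :=
    SemidirectProduct.lift g₁ (zpowersHom _ (of (Γ.cone S) none)) fun z =>
      MonoidHom.ext fun n => map_zpow_action φ g₁ _ hg₁ z n
  refine ⟨f, injective_of_leftInverse (g := g) ?_⟩
  rintro (_ | v)
  · simp [f, g, t]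
  · simp [f, g, i, hg₁of]

end Cone

end TwistedRAAG

/-- Every graph in the class `R` is finite, and its twisted Artin group has bounded Parikh images
and a primitive recursive word problem. -/
theorem ClassR.finite_and_bounded {V : Type u} {Γ : MixedGraph V} (h : Γ.ClassR) :
    Finite V ∧ ParikhBounded Γ.TwistedRAAG ∧ PrimrecWordProblem Γ.TwistedRAAG := by
  have hcone : ∀ {V : Type u} (Γ : MixedGraph V) (S : Set V), (Finite V ∧
      ParikhBounded Γ.TwistedRAAG ∧ PrimrecWordProblem Γ.TwistedRAAG) → Finite (Option V) ∧
      ParikhBounded (Γ.cone S).TwistedRAAG ∧ PrimrecWordProblem (Γ.cone S).TwistedRAAG := by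
    rintro V Γ S ⟨hV, hP, hW⟩
    obtain ⟨f, hf⟩ := TwistedRAAG.exists_injective_semidirectProduct Γ S
    let _ : Primcodable ℤˣ := Primcodable.ofEquiv (Fin (Fintype.card ℤˣ)) (Fintype.equivFin ℤˣ)
    exact ⟨inferInstance, (hP.semidirectProduct _ _).of_injective f hf,
      (hW.semidirectProduct _ _).of_injective f hf⟩
  have hiso : ∀ {V W : Type u} {Γ : MixedGraph V} {Δ : MixedGraph W} (e : V ≃ W),
      (∀ a b, Δ.graph.Adj (e a) (e b) ↔ Γ.graph.Adj a b) →
      (∀ a b, Δ.Dir (e a) (e b) ↔ Γ.Dir a b) →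
      (Finite V ∧ ParikhBounded Γ.TwistedRAAG ∧ PrimrecWordProblem Γ.TwistedRAAG) →
      Finite W ∧ ParikhBounded Δ.TwistedRAAG ∧ PrimrecWordProblem Δ.TwistedRAAG := by
    rintro V W Γ Δ e ha hd ⟨hV, hP, hW⟩
    obtain ⟨f, hf⟩ := TwistedRAAG.exists_injective_of_equiv e ha hd
    exact ⟨Finite.of_equiv V e, hP.of_injective f hf, hW.of_injective f hf⟩
  induction h with
  | @single V _ Γ =>
    -- The single vertex is treated as the cone over the empty graph, whose group is trivial.
    let Δ : MixedGraph PEmpty.{u + 1} := ⟨⊥, fun a _ => a.elim, fun a => a.elim, fun a => a.elim⟩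
    have : Subsingleton Δ.TwistedRAAG := TwistedRAAG.subsingleton_of_isEmpty
    let e : Option PEmpty.{u + 1} ≃ V := Equiv.ofUnique _ _
    have hadj : ∀ a b, ¬ Γ.graph.Adj a b := fun a b h =>
      Γ.graph.irrefl (Subsingleton.elim a b ▸ h : Γ.graph.Adj a a)
    refine hiso e ?_ ?_ (hcone Δ ∅ ⟨inferInstance, ParikhBounded.of_subsingleton,
      PrimrecWordProblem.of_subsingleton⟩)
    · rintro (_ | a) (_ | b)
      · exact ⟨fun h => (hadj _ _ h).elim, fun h => h.elim⟩
      all_goals exact PEmpty.elim ‹_›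
    · rintro (_ | a) (_ | b)
      · exact ⟨fun h => (hadj _ _ (Γ.adj_of_dir _ _ h)).elim, fun h => h.elim⟩
      all_goals exact PEmpty.elim ‹_›
  | @disjointUnion V W Γ Δ _ _ ihΓ ihΔ =>
    obtain ⟨hV, hPΓ, hWΓ⟩ := ihΓ
    obtain ⟨hW, hPΔ, hWΔ⟩ := ihΔ
    obtain ⟨f, hf⟩ := TwistedRAAG.exists_injective_coprodI Γ Δ
    refine ⟨inferInstance, (ParikhBounded.coprodI ?_).of_injective f hf,
      (PrimrecWordProblem.coprodI ?_).of_injective f hf⟩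
    · rintro (_ | _)
      exacts [hPΔ, hPΓ]
    · rintro (_ | _)
      exacts [hWΔ, hWΓ]
  | cone S _ ih => exact hcone _ S ih
  | iso e ha hd _ ih => exact hiso e ha hd ih

end MixedGraph

/-! ### Short runs with a prescribed value -/

/-- In a finite labelled graph, the shortest path whose label has the same value as a word `w` over
a finite subset `Y` is bounded by a primitive recursive function of the sizes of the graph and of
`w`. -/
theorem ParikhBounded.exists_run_card_le {G : Type*} [Group G] (hG : ParikhBounded G) {Y : Set G}
    (hY : Y.Finite) : ∃ F : ℕ → ℕ, Primrec F ∧ ∀ w : List G, (∀ g ∈ w, g ∈ Y) →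
      ∀ (m : ℕ) (V E : Type) [Finite V] [Finite E] (src tgt : E → V) (lab : E → G),
      Nat.card V + w.length ≤ m → Nat.card E + w.length ≤ m → (∀ e, lab e ∈ Y ∨ (lab e)⁻¹ ∈ Y) →
      ∀ p q, (∃ x, Run src tgt lab p q w.prod x) →
      ∃ x : Multiset E, x.card ≤ F m ∧ Run src tgt lab p q w.prod x := by
  obtain ⟨F, hF, h⟩ := hG (Y ∪ Y⁻¹) (hY.union hY.inv)
  refine ⟨F, hF, fun w => ?_⟩
  induction w with
  | nil =>
    intro _ m V E _ _ src tgt lab hV hE hlab p q hx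
    obtain ⟨x, hx, hc⟩ := (h m V E src tgt lab (by simpa using hV) (by simpa using hE) hlab
      p q).exists_card_le hx
    exact ⟨x, hc, hx⟩
  | cons a w ih =>
    rintro hw m V E _ _ src tgt lab hV hE hlab p q ⟨x, hx⟩
    rw [List.length_cons] at hV hE
    rw [List.prod_cons] at hx ⊢
    -- A new initial vertex `none` has one edge to `p`, labelled `a⁻¹`. A run from `p` of value `a *
    -- w.prod` thus becomes a run from `none` of value `w.prod`.
    let src' : Option E → Option V := fun e => e.elim none fun e => some (src e)
    let tgt' : Option E → Option V := fun e => e.elim (some p) fun e => some (tgt e)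
    let lab' : Option E → G := fun e => e.elim a⁻¹ lab
    have hx' : Run src' tgt' lab' (some p) (some q) (a * w.prod) (x.map some) :=
      hx.map (src' := src') (tgt' := tgt') (lab' := lab') some some (MonoidHom.id G)
        (fun _ => rfl) (fun _ => rfl) fun _ => rfl
    have hx'' : Run src' tgt' lab' none (some q) w.prod (none ::ₘ x.map some) :=
      (Run.cons (src := src') (lab := lab') none hx').cast rfl rfl
        (inv_mul_cancel_left a w.prod) rfl
    -- One letter is traded for one vertex and one edge, so the same `m` serves throughout the
    -- induction.
    obtain ⟨y, hy, hr⟩ := ih (fun g hg => hw g (List.mem_cons_of_mem _ hg)) m (Option V) (Option E)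
      src' tgt' lab' (by rw [Finite.card_option]; omega) (by rw [Finite.card_option]; omega)
      (by
        rintro (_ | e)
        · exact Or.inr (by simpa [lab'] using hw a List.mem_cons_self)
        · exact hlab e) none (some q) ⟨_, hx''⟩
    -- No edge ends at `none`, so a run from `none` uses the new edge exactly once, at its start;
    -- deleting it gives a run from `p` of no greater length.
    have key : ∀ {P Q : Option V} {g : G} {y : Multiset (Option E)}, Run src' tgt' lab' P Q g y →
        Q = some q → ∃ z : Multiset E, z.card ≤ y.card ∧
          (∀ p', P = some p' → Run src tgt lab p' q g z) ∧
          (P = none → Run src tgt lab p q (a * g) z) := by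
      intro P Q g y hr
      induction hr with
      | nil P =>
        rintro rfl
        exact ⟨0, le_rfl, fun p' hp => Option.some_injective _ hp ▸ Run.nil _, fun h => by simp at h⟩
      | cons e _ ih =>
        intro hQ
        obtain ⟨z, hz, h₁, h₂⟩ := ih hQ
        rcases e with _ | e
        · refine ⟨z, hz.trans (by simp), fun p' hp => by simp [src'] at hp, fun _ => ?_⟩
          exact (h₁ p rfl).cast rfl rfl (mul_inv_cancel_left a _).symm rfl
        · refine ⟨e ::ₘ z, by simpa using hz, fun p' hp => ?_, fun h => by simp [src'] at h⟩
          obtain rfl : src e = p' := Option.some_injective _ hp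
          exact Run.cons e (h₁ _ rfl)
    obtain ⟨z, hz, -, h₂⟩ := key hr rfl
    exact ⟨z, hz.trans hy, h₂ rfl⟩

theorem natCard_mem_list_le {α : Type*} (l : List α) : Nat.card {a // a ∈ l} ≤ l.length := by
  classical
  rw [Nat.card_congr (Equiv.subtypeEquivRight fun a => (List.mem_toFinset (l := l)).symm),
    Nat.card_eq_fintype_card, Fintype.card_coe]
  exact l.toFinset_card_le

instance finite_mem_list {α : Type*} (l : List α) : Finite {a // a ∈ l} :=
  List.finite_toSet l

/-! ### Primitive recursive enumeration and comparison of values -/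

/-- The lists of length at most `k` with entries in `l`. -/
def boundedLists {α : Type*} (l : List α) : ℕ → List (List α)
  | 0 => [[]]
  | k + 1 => [] :: l.flatMap fun a => (boundedLists l k).map (List.cons a)

theorem mem_boundedLists {α : Type*} {l : List α} {k : ℕ} {t : List α} :
    t ∈ boundedLists l k ↔ t.length ≤ k ∧ ∀ a ∈ t, a ∈ l := by
  induction k generalizing t with
  | zero => cases t <;> simp [boundedLists]
  | succ k ih =>
    cases t with
    | nil => simp [boundedLists]
    | cons a t => simp [boundedLists, ih]; tauto

theorem primrec_boundedLists {α : Type*} [Primcodable α] :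
    Primrec₂ (boundedLists : List α → ℕ → List (List α)) := by
  have hmap : Primrec₂ fun (p : List α × ℕ × List (List α)) (a : α) =>
      p.2.2.map (List.cons a) := by
    have h : Primrec₂ fun (p : (List α × ℕ × List (List α)) × α) (t : List α) => p.2 :: t :=
      (Primrec.list_cons.comp (Primrec.snd.comp Primrec.fst) Primrec.snd).to₂
    exact (Primrec.list_map (Primrec.snd.comp (Primrec.snd.comp Primrec.fst)) h).to₂
  have hstep : Primrec₂ fun (l : List α) (p : ℕ × List (List α)) =>
      ([] : List α) :: l.flatMap fun a => p.2.map (List.cons a) :=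
    (Primrec.list_cons.comp (Primrec.const []) (Primrec.list_flatMap Primrec.fst hmap)).to₂
  refine (Primrec.nat_rec (Primrec.const [[]]) hstep).of_eq fun l k => ?_
  induction k with
  | zero => rfl
  | succ k ih => simp only [boundedLists, ← ih]

theorem PrimrecWordProblem.primrecRel_wordValue_eq {G : Type*} [Group G] (hG : PrimrecWordProblem G)
    {n : ℕ} (φ : Fin n → G) :
    PrimrecRel fun u w : List (Fin n) => wordValue φ u = wordValue φ w := by
  have h := hG (Fin n ⊕ Fin n) (Sum.elim φ fun a => (φ a)⁻¹)
  have hinl : Primrec₂ fun (_ : List (Fin n) × List (Fin n)) (a : Fin n) =>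
    (Sum.inl a : Fin n ⊕ Fin n) := (Primrec.sumInl.comp Primrec.snd).to₂
  have hinr : Primrec₂ fun (_ : List (Fin n) × List (Fin n)) (a : Fin n) =>
    (Sum.inr a : Fin n ⊕ Fin n) := (Primrec.sumInr.comp Primrec.snd).to₂
  have hf : Primrec fun p : List (Fin n) × List (Fin n) =>
      p.1.map (Sum.inl : Fin n → Fin n ⊕ Fin n) ++ p.2.reverse.map Sum.inr :=
    Primrec.list_append.comp (Primrec.list_map Primrec.fst hinl)
      (Primrec.list_map (Primrec.list_reverse.comp Primrec.snd) hinr)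
  refine (h.comp hf).of_eq fun p => ?_
  have : (p.2.reverse.map fun a => (φ a)⁻¹).prod = (wordValue φ p.2)⁻¹ := by
    rw [wordValue, List.prod_inv_reverse, List.map_map, List.map_reverse]; rfl
  rw [List.map_append, List.prod_append, List.map_map, List.map_map,
    show (Sum.elim φ fun a => (φ a)⁻¹) ∘ Sum.inr = fun a => (φ a)⁻¹ from rfl, this,
    show (Sum.elim φ fun a => (φ a)⁻¹) ∘ Sum.inl = φ from rfl, mul_inv_eq_one]
  rfl

/-! ### Rational subsets -/

namespace AutomatonCode

variable {n : ℕ}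

/-- The state after a transition, `none` if the transition does not start at the current state. -/
def move (s : Option ℕ) (e : ℕ × Fin n × ℕ) : Option ℕ :=
  if s = some e.1 then some e.2.2 else none

theorem foldl_move_none (t : List (ℕ × Fin n × ℕ)) : t.foldl move none = none := by
  induction t with
  | nil => rfl
  | cons e t ih => simpa [move] using ih

theorem foldl_move_cons {s q : ℕ} {e : ℕ × Fin n × ℕ} {t : List (ℕ × Fin n × ℕ)} :
    (e :: t).foldl move (some s) = some q ↔ s = e.1 ∧ t.foldl move (some e.2.2) = some q := by
  by_cases h : s = e.1
  · simp [move, h]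
  · simp [move, h, foldl_move_none]

/-- The word read along a list of transitions. -/
def letters (t : List (ℕ × Fin n × ℕ)) : List (Fin n) := t.map fun e => e.2.1

theorem mem_evalFrom_toNFA (c : AutomatonCode n) {s q : ℕ} {u : List (Fin n)} :
    q ∈ c.toNFA.evalFrom {s} u ↔
      ∃ t : List (ℕ × Fin n × ℕ), (∀ e ∈ t, e ∈ c.1) ∧ letters t = u ∧
        t.foldl move (some s) = some q := by
  induction u generalizing s with
  | nil =>
    simp only [NFA.evalFrom_nil, Set.mem_singleton_iff, letters, List.map_eq_nil_iff]
    refine ⟨fun h => ⟨[], by simp, rfl, by simp [h]⟩, ?_⟩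
    rintro ⟨t, -, rfl, h⟩
    simpa using h.symm
  | cons a u ih =>
    rw [NFA.evalFrom_cons, NFA.stepSet_singleton, NFA.mem_evalFrom_iff_exists]
    constructor
    · rintro ⟨r, hr, hq⟩
      obtain ⟨t, ht, hu, hf⟩ := ih.1 hq
      refine ⟨(s, a, r) :: t, ?_, by simpa [letters] using hu, foldl_move_cons.2 ⟨rfl, hf⟩⟩
      intro e he
      rcases List.mem_cons.1 he with rfl | he
      · exact hr
      · exact ht e he
    · rintro ⟨_ | ⟨⟨s', a', r⟩, t⟩, ht, hu, hf⟩
      · simp [letters] at hu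
      · obtain ⟨rfl, hf⟩ := foldl_move_cons.1 hf
        simp only [letters, List.map_cons, List.cons.injEq] at hu
        obtain ⟨rfl, hu⟩ := hu
        exact ⟨r, ht _ List.mem_cons_self,
          ih.2 ⟨t, fun e he => ht e (List.mem_cons_of_mem _ he), hu, hf⟩⟩

theorem mem_accepts_toNFA (c : AutomatonCode n) {u : List (Fin n)} :
    u ∈ c.toNFA.accepts ↔ ∃ t : List (ℕ × Fin n × ℕ), (∀ e ∈ t, e ∈ c.1) ∧ letters t = u ∧
      ∃ s ∈ c.2.1, ∃ q ∈ c.2.2, t.foldl move (some s) = some q := by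
  rw [NFA.mem_accepts]
  simp only [NFA.mem_evalFrom_iff_exists (S := c.toNFA.start), mem_evalFrom_toNFA]
  constructor
  · rintro ⟨q, hq, s, hs, t, ht, hu, hf⟩
    exact ⟨t, ht, hu, s, hs, q, hq, hf⟩
  · rintro ⟨t, ht, hu, s, hs, q, hq, hf⟩
    exact ⟨q, hq, s, hs, t, ht, hu, hf⟩

/-- The states which occur in the description of an automaton. -/
def states (c : AutomatonCode n) : List ℕ :=
  c.2.1 ++ (c.2.2 ++ (c.1.map (fun e => e.1) ++ c.1.map fun e => e.2.2))

theorem source_mem_states {c : AutomatonCode n} {e : ℕ × Fin n × ℕ} (he : e ∈ c.1) :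
    e.1 ∈ c.states := by
  simp only [states, List.mem_append]
  exact Or.inr (Or.inr (Or.inl (List.mem_map_of_mem he)))

theorem target_mem_states {c : AutomatonCode n} {e : ℕ × Fin n × ℕ} (he : e ∈ c.1) :
    e.2.2 ∈ c.states := by
  simp only [states, List.mem_append]
  exact Or.inr (Or.inr (Or.inr (List.mem_map_of_mem (f := fun e => e.2.2) he)))

theorem primrec_states : Primrec (states : AutomatonCode n → List ℕ) := by
  have h₁ : Primrec₂ fun (_ : AutomatonCode n) (e : ℕ × Fin n × ℕ) => e.1 :=
    (Primrec.fst.comp Primrec.snd).to₂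
  have h₂ : Primrec₂ fun (_ : AutomatonCode n) (e : ℕ × Fin n × ℕ) => e.2.2 :=
    (Primrec.snd.comp (Primrec.snd.comp Primrec.snd)).to₂
  exact Primrec.list_append.comp (Primrec.fst.comp Primrec.snd)
    (Primrec.list_append.comp (Primrec.snd.comp Primrec.snd)
      (Primrec.list_append.comp (Primrec.list_map Primrec.fst h₁)
        (Primrec.list_map Primrec.fst h₂)))

section Graph

variable {G : Type*} [Monoid G] (φ : Fin n → G) (c : AutomatonCode n)

/-- Paths in the graph of an automaton, labelled by the values of their words. -/
abbrev GraphRun : {q // q ∈ c.states} → {q // q ∈ c.states} → G → Multiset {e // e ∈ c.1} → Prop :=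
  Run (fun e => ⟨e.1.1, source_mem_states e.2⟩) (fun e => ⟨e.1.2.2, target_mem_states e.2⟩)
    fun e => φ e.1.2.1

variable {φ c}

theorem GraphRun.exists_list {P Q : {q // q ∈ c.states}} {g : G} {x : Multiset {e // e ∈ c.1}}
    (h : GraphRun φ c P Q g x) : ∃ t : List (ℕ × Fin n × ℕ), t.length = x.card ∧
      (∀ e ∈ t, e ∈ c.1) ∧ wordValue φ (letters t) = g ∧ t.foldl move (some P.1) = some Q.1 := by
  induction h with
  | nil P => exact ⟨[], by simp, by simp, rfl, rfl⟩
  | cons e _ ih =>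
    obtain ⟨t, hl, ht, hg, hf⟩ := ih
    refine ⟨e.1 :: t, by simp [hl], ?_, by simp [letters, wordValue, ← hg],
      foldl_move_cons.2 ⟨rfl, hf⟩⟩
    intro e' he'
    rcases List.mem_cons.1 he' with rfl | he'
    · exact e.2
    · exact ht e' he'

theorem GraphRun.exists_of_list {t : List (ℕ × Fin n × ℕ)} (ht : ∀ e ∈ t, e ∈ c.1)
    {P Q : {q // q ∈ c.states}} (h : t.foldl move (some P.1) = some Q.1) :
    ∃ x, GraphRun φ c P Q (wordValue φ (letters t)) x := by
  induction t generalizing P with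
  | nil =>
    obtain rfl : P = Q := Subtype.ext (Option.some_injective _ h)
    exact ⟨0, Run.nil _⟩
  | cons e t ih =>
    have he : e ∈ c.1 := ht e List.mem_cons_self
    obtain ⟨hP, hf⟩ := foldl_move_cons.1 h
    obtain ⟨x, hx⟩ := ih (fun e' he' => ht e' (List.mem_cons_of_mem _ he'))
      (P := ⟨e.2.2, target_mem_states he⟩) hf
    exact ⟨⟨e, he⟩ ::ₘ x, (Run.cons (src := fun e : {e // e ∈ c.1} =>
      (⟨e.1.1, source_mem_states e.2⟩ : {q // q ∈ c.states})) ⟨e, he⟩ hx).cast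
      (Subtype.ext hP.symm) rfl (by simp [letters, wordValue]) rfl⟩

end Graph

theorem primrecRel_exists_path : PrimrecRel fun (t : List (ℕ × Fin n × ℕ)) (c : AutomatonCode n) =>
    ∃ s ∈ c.2.1, ∃ q ∈ c.2.2, t.foldl move (some s) = some q := by
  have hmove : Primrec₂ fun (_ : ℕ × ℕ × List (ℕ × Fin n × ℕ))
      (p : Option ℕ × ℕ × Fin n × ℕ) => move p.1 p.2 := by
    refine Primrec.ite (Primrec.eq.comp (Primrec.fst.comp Primrec.snd) ?_) ?_ (Primrec.const none)
    · exact Primrec.option_some.comp (Primrec.fst.comp (Primrec.snd.comp Primrec.snd))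
    · exact Primrec.option_some.comp
        (Primrec.snd.comp (Primrec.snd.comp (Primrec.snd.comp Primrec.snd)))
  have h₁ : PrimrecRel fun (q : ℕ) (b : ℕ × List (ℕ × Fin n × ℕ)) =>
      b.2.foldl move (some b.1) = some q :=
    Primrec.eq.comp (Primrec.list_foldl (Primrec.snd.comp Primrec.snd)
      (Primrec.option_some.comp (Primrec.fst.comp Primrec.snd)) hmove)
      (Primrec.option_some.comp Primrec.fst)
  have h₂ : PrimrecRel fun (s : ℕ) (b : List (ℕ × Fin n × ℕ) × List ℕ) =>
      ∃ q ∈ b.2, b.1.foldl move (some s) = some q :=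
    h₁.exists_mem_list.comp (Primrec.snd.comp Primrec.snd)
      (Primrec.pair Primrec.fst (Primrec.fst.comp Primrec.snd))
  exact h₂.exists_mem_list.comp (Primrec.fst.comp (Primrec.snd.comp Primrec.snd))
    (Primrec.pair Primrec.fst (Primrec.snd.comp (Primrec.snd.comp Primrec.snd)))

end AutomatonCode

open AutomatonCode in
-- The search runs over all lists of transitions of length at most `F` of the input size. Bounding
-- the length of the path, rather than only of its word, makes the test for acceptance elementary.
theorem ParikhBounded.computablePred_rational {G : Type*} [Group G] (hG : ParikhBounded G)
    (hW : PrimrecWordProblem G) {n : ℕ} (φ : Fin n → G) :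
    ComputablePred fun p : AutomatonCode n × List (Fin n) =>
      wordValue φ p.2 ∈ wordValue φ '' (p.1.toNFA.accepts : Set (List (Fin n))) := by
  obtain ⟨F, hF, h⟩ := hG.exists_run_card_le (Set.finite_range φ)
  let size (p : AutomatonCode n × List (Fin n)) : ℕ :=
    p.1.states.length + p.1.1.length + p.2.length
  have hsize : Primrec size :=
    Primrec.nat_add.comp (Primrec.nat_add.comp
      (Primrec.list_length.comp (primrec_states.comp Primrec.fst))
      (Primrec.list_length.comp (Primrec.fst.comp Primrec.fst)))
      (Primrec.list_length.comp Primrec.snd)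
  have hletters : Primrec (letters : List (ℕ × Fin n × ℕ) → List (Fin n)) := by
    have h₁ : Primrec₂ fun (_ : List (ℕ × Fin n × ℕ)) (e : ℕ × Fin n × ℕ) => e.2.1 :=
      (Primrec.fst.comp (Primrec.snd.comp Primrec.snd)).to₂
    exact Primrec.list_map Primrec.id h₁
  have hR : PrimrecRel fun (t : List (ℕ × Fin n × ℕ)) (p : AutomatonCode n × List (Fin n)) =>
      wordValue φ (letters t) = wordValue φ p.2 ∧
        ∃ s ∈ p.1.2.1, ∃ q ∈ p.1.2.2, t.foldl move (some s) = some q :=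
    ((hW.primrecRel_wordValue_eq φ).comp (hletters.comp Primrec.fst)
      (Primrec.snd.comp Primrec.snd)).and
      (primrecRel_exists_path.comp Primrec.fst (Primrec.fst.comp Primrec.snd))
  refine ((hR.exists_mem_list.comp (primrec_boundedLists.comp (Primrec.fst.comp Primrec.fst)
    (hF.comp hsize)) Primrec.id).of_eq fun p => ?_).computablePred
  obtain ⟨c, w⟩ := p
  simp only [mem_boundedLists]
  constructor
  · rintro ⟨t, ⟨-, ht⟩, hv, hp⟩
    exact ⟨letters t, (mem_accepts_toNFA c).2 ⟨t, ht, rfl, hp⟩, hv⟩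
  · rintro ⟨u, hu, hv⟩
    obtain ⟨t, ht, rfl, s, hs, q, hq, hf⟩ := (mem_accepts_toNFA c).1 hu
    have hs' : s ∈ states c := List.mem_append_left _ hs
    have hq' : q ∈ states c := List.mem_append_right _ (List.mem_append_left _ hq)
    have hVc := natCard_mem_list_le (states c)
    have hEc := natCard_mem_list_le c.1
    obtain ⟨x, hx⟩ := GraphRun.exists_of_list (φ := φ) ht (P := ⟨s, hs'⟩) (Q := ⟨q, hq'⟩) hf
    obtain ⟨y, hy, hr⟩ := h (w.map φ) (by simp) (size (c, w)) _ _ _ _ _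
      (by simp only [size, List.length_map]; omega) (by simp only [size, List.length_map]; omega)
      (fun e => Or.inl ⟨_, rfl⟩) ⟨s, hs'⟩ ⟨q, hq'⟩ ⟨x, hx.cast rfl rfl hv rfl⟩
    obtain ⟨t', hl, ht', hg, hf'⟩ := GraphRun.exists_list hr
    exact ⟨t', ⟨hl.trans_le hy, ht'⟩, hg, s, hs, q, hq, hf'⟩

/-! ### Submonoids -/

namespace SubmonoidGraph

variable {α : Type}

/-- The suffixes of the words in `S`, and the empty word. -/
def suffixes (S : List (List α)) : List (List α) := [] :: S.flatMap List.tails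

theorem nil_mem_suffixes (S : List (List α)) : [] ∈ suffixes S := List.mem_cons_self

theorem mem_suffixes_of_mem {S : List (List α)} {s : List α} (hs : s ∈ S) : s ∈ suffixes S :=
  List.mem_cons_of_mem _ (List.mem_flatMap.2 ⟨s, hs, (List.mem_tails s s).2 List.suffix_rfl⟩)

theorem tail_mem_suffixes {S : List (List α)} {v : List α} (hv : v ∈ suffixes S) :
    v.tail ∈ suffixes S := by
  rcases List.mem_cons.1 hv with rfl | hv
  · exact hv
  · obtain ⟨s, hs, hvs⟩ := List.mem_flatMap.1 hv
    exact List.mem_cons_of_mem _ (List.mem_flatMap.2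
      ⟨s, hs, (List.mem_tails _ _).2 ((List.tail_suffix v).trans ((List.mem_tails _ _).1 hvs))⟩)

theorem length_suffixes (S : List (List α)) :
    (suffixes S).length = S.flatten.length + S.length + 1 := by
  induction S with
  | nil => rfl
  | cons s S ih =>
    simp only [suffixes, List.flatMap_cons, List.length_cons, List.length_append,
      List.length_tails, List.flatten_cons] at ih ⊢
    omega

variable {n : ℕ} {G : Type*} [Monoid G] (φ : Fin n → G) (S : List (List (Fin n)))

/-- Paths in the graph whose vertices are the suffixes of the words in `S`. From every suffix there
is an edge to its tail, labelled by its first letter, and from the empty word there is an edge with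
trivial label to every word in `S`. -/
abbrev GraphRun : {v // v ∈ suffixes S} → {v // v ∈ suffixes S} → G →
    Multiset ({v // v ∈ suffixes S} ⊕ {s // s ∈ S}) → Prop :=
  Run (Sum.elim id fun _ => ⟨[], nil_mem_suffixes S⟩)
    (Sum.elim (fun v => ⟨v.1.tail, tail_mem_suffixes v.2⟩) fun s => ⟨s.1, mem_suffixes_of_mem s.2⟩)
    (Sum.elim (fun v => wordValue φ (v.1.take 1)) fun _ => 1)

variable {φ S}

theorem wordValue_take_one_mul (v : List (Fin n)) :
    wordValue φ (v.take 1) * wordValue φ v.tail = wordValue φ v := by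
  cases v <;> simp [wordValue]

/-- Starting at `P`, a run first reads the rest of `P`. Each later edge out of the empty word that
chooses some `s ∈ S` adds a factor, so the number of factors is at most the number of edges. -/
theorem GraphRun.exists_list {P Q : {v // v ∈ suffixes S}} {g : G}
    {x : Multiset ({v // v ∈ suffixes S} ⊕ {s // s ∈ S})} (h : GraphRun φ S P Q g x)
    (hQ : Q.1 = []) : ∃ t : List (List (Fin n)), t.length ≤ x.card ∧ (∀ s ∈ t, s ∈ S) ∧
      wordValue φ P.1 * wordValue φ t.flatten = g := by
  induction h with
  | nil P => exact ⟨[], by simp, by simp, by simp [wordValue, hQ]⟩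
  | cons e _ ih =>
    obtain ⟨t, hl, ht, hg⟩ := ih hQ
    rcases e with v | s
    · refine ⟨t, hl.trans (by simp), ht, ?_⟩
      rw [← hg, ← mul_assoc]
      exact congrArg (· * _) (wordValue_take_one_mul v.1).symm
    · refine ⟨s.1 :: t, by simpa using hl, ?_, ?_⟩
      · intro s' hs'
        rcases List.mem_cons.1 hs' with rfl | hs'
        · exact s.2
        · exact ht s' hs'
      · rw [← hg]
        simp [wordValue]

theorem GraphRun.exists_of_suffix {v : List (Fin n)} (hv : v ∈ suffixes S) :
    ∃ x, GraphRun φ S ⟨v, hv⟩ ⟨[], nil_mem_suffixes S⟩ (wordValue φ v) x := by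
  induction v with
  | nil => exact ⟨0, Run.nil _⟩
  | cons a v ih =>
    obtain ⟨x, hx⟩ := ih (tail_mem_suffixes hv)
    exact ⟨_, (Run.cons (Sum.inl ⟨a :: v, hv⟩) hx).cast rfl rfl (wordValue_take_one_mul _) rfl⟩

theorem GraphRun.exists_of_list {t : List (List (Fin n))} (ht : ∀ s ∈ t, s ∈ S) :
    ∃ x, GraphRun φ S ⟨[], nil_mem_suffixes S⟩ ⟨[], nil_mem_suffixes S⟩
      (wordValue φ t.flatten) x := by
  induction t with
  | nil => exact ⟨0, Run.nil _⟩
  | cons s t ih =>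
    have hs : s ∈ S := ht s List.mem_cons_self
    obtain ⟨x, hx⟩ := GraphRun.exists_of_suffix (φ := φ) (mem_suffixes_of_mem hs)
    obtain ⟨y, hy⟩ := ih fun s' hs' => ht s' (List.mem_cons_of_mem _ hs')
    exact ⟨_, (Run.cons (Sum.inr ⟨s, hs⟩) (hx.append hy)).cast rfl rfl
      (by simp [wordValue]) rfl⟩

end SubmonoidGraph

open SubmonoidGraph in
-- Short runs in the graph of suffixes bound the number of factors from `S` that are needed, so the
-- search runs over the bounded lists of words in `S`.
theorem ParikhBounded.computablePred_submonoid {G : Type*} [Group G] (hG : ParikhBounded G)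
    (hW : PrimrecWordProblem G) {n : ℕ} (φ : Fin n → G) :
    ComputablePred fun p : List (List (Fin n)) × List (Fin n) =>
      wordValue φ p.2 ∈
        wordValue φ '' ((KStar.kstar ({s | s ∈ p.1} : Language (Fin n)) :
          Language (Fin n)) : Set (List (Fin n))) := by
  -- The label `1` occurs on the edges that choose a word of `S`, and on the loop at the empty word,
  -- whose tail is again empty.
  obtain ⟨F, hF, h⟩ := hG.exists_run_card_le ((Set.finite_range φ).insert 1)
  let size (p : List (List (Fin n)) × List (Fin n)) : ℕ :=
    p.1.flatten.length + p.1.length + 1 + p.1.length + p.2.length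
  have hlen : Primrec fun p : List (List (Fin n)) × List (Fin n) => p.1.length :=
    Primrec.list_length.comp Primrec.fst
  have hsize : Primrec size :=
    Primrec.nat_add.comp (Primrec.nat_add.comp (Primrec.succ.comp (Primrec.nat_add.comp
      (Primrec.list_length.comp (Primrec.list_flatten.comp Primrec.fst)) hlen)) hlen)
      (Primrec.list_length.comp Primrec.snd)
  have hR : PrimrecRel fun (t : List (List (Fin n))) (p : List (List (Fin n)) × List (Fin n)) =>
      wordValue φ t.flatten = wordValue φ p.2 :=
    (hW.primrecRel_wordValue_eq φ).comp (Primrec.list_flatten.comp Primrec.fst)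
      (Primrec.snd.comp Primrec.snd)
  refine ((hR.exists_mem_list.comp (primrec_boundedLists.comp Primrec.fst
    (hF.comp hsize)) Primrec.id).of_eq fun p => ?_).computablePred
  obtain ⟨S, w⟩ := p
  simp only [mem_boundedLists]
  constructor
  · rintro ⟨t, ⟨-, ht⟩, hv⟩
    exact ⟨t.flatten, Language.mem_kstar.2 ⟨t, rfl, ht⟩, hv⟩
  · rintro ⟨u, hu, hv⟩
    obtain ⟨t, rfl, ht⟩ := Language.mem_kstar.1 hu
    have hVc := natCard_mem_list_le (suffixes S)
    have hEc := natCard_mem_list_le S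
    rw [length_suffixes] at hVc
    obtain ⟨x, hx⟩ := GraphRun.exists_of_list (φ := φ) ht
    obtain ⟨y, hy, hr⟩ := h (w.map φ) (by simp) (size (S, w)) _ _ _ _ _
      (by simp only [size, List.length_map]; omega)
      (by rw [Nat.card_sum]; simp only [size, List.length_map]; omega)
      (by
        rintro (⟨_ | ⟨a, v⟩, hv⟩ | s)
        · exact Or.inl (Or.inl rfl)
        · exact Or.inl (Or.inr ⟨a, by simp [wordValue]⟩)
        · exact Or.inl (Or.inl rfl)) _ _ ⟨x, hx.cast rfl rfl hv rfl⟩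
    obtain ⟨t', hl, ht', hg⟩ := GraphRun.exists_list hr rfl
    exact ⟨t', ⟨hl.trans hy, ht'⟩, by simpa [wordValue] using hg⟩

theorem MixedGraph.TwistedRAAG.monoid_fg {V : Type*} [Finite V] (Γ : MixedGraph V) :
    Monoid.FG Γ.TwistedRAAG := by
  have : Group.FG Γ.TwistedRAAG :=
    Group.fg_of_surjective (f := PresentedGroup.mk Γ.relators) (PresentedGroup.mk_surjective _)
  exact Group.fg_iff_monoid_fg.1 this

theorem theorem5p8 {V : Type u} (Γ : MixedGraph V) (hΓ : Γ.ClassR) :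
    DecidableRationalSubsetMembership Γ.TwistedRAAG ∧
      DecidableSubmonoidMembership Γ.TwistedRAAG := by
  obtain ⟨_, hG, hW⟩ := hΓ.finite_and_bounded
  have hfg := MixedGraph.TwistedRAAG.monoid_fg Γ
  exact ⟨⟨hfg, fun n φ _ => hG.computablePred_rational hW φ⟩,
    ⟨hfg, fun n φ _ => hG.computablePred_submonoid hW φ⟩⟩
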